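/- Let $\mathcal U,\mathcal V,\mathcal X$ be finite-dimensional real Euclidean spaces, with $\mathcal U\times\mathcal V$ carrying the product inner product, and write $w=(u,v)$, $\|z\|_G^2=\langle z,Gz\rangle$. Let $\mathcal A:\mathcal X\to\mathcal U$ and $\mathcal B:\mathcal X\to\mathcal V$ be linear, $c\in\mathcal X$, let $p:\mathcal U\to(-\infty,\infty]$ and $q:\mathcal V\to(-\infty,\infty]$ be closed proper convex functions and let $\phi:\mathcal U\times\mathcal V\to\mathbb R$ be convex and differentiable with Lipschitz continuous gradient. Consider $$\min_{u,v}\; p(u)+q(v)+\phi(u,v)\quad\text{subject to}\quad \mathcal A^*u+\mathcal B^*v=c .\qquad (P)$$ Let $\partial^2\phi(w)$ be Clarke's generalized Hessian, i.e. the convex hull of all limits of $\nabla^2\phi(w^j)$ along sequences $w^j\to w$ of points where $\nabla^2\phi$ exists. Let $\mathcal Q$ on $\mathcal U\times\mathcal V$ and $\mathcal D_1,\mathcal S$ on $\mathcal U$, $\mathcal D_2,\mathcal T$ on $\mathcal V$ be self-adjoint positive semidefinite operators, put $\mathcal H=\mathrm{Diag}(\mathcal D_1,\mathcal D_2)$,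 and let $\eta\in[0,1]$, $\sigma>0$. Suppose that for all $w$ and all $\mathcal W\in\partial^2\phi(w)$ $$\mathcal Q\preceq\mathcal W\preceq\mathcal Q+\mathcal H,\qquad |\langle u',(\mathcal W_{12}-\mathcal Q_{12})v'\rangle|\le\tfrac{\eta}{2}\bigl(\|u'\|_{\mathcal D_1}^2+\|v'\|_{\mathcal D_2}^2\bigr)\quad\forall\,u'\in\mathcal U,\ v'\in\mathcal V,$$ where $\mathcal W_{12},\mathcal Q_{12}:\mathcal V\to\mathcal U$ are the upper right blocks of $\mathcal W,\mathcal Q$. Put $\hat\phi(w;w')=\phi(w')+\langle\nabla\phi(w'),w-w'\rangle+\frac12\|w'-w\|^2_{\mathcal Q+\mathcal H}$ and $$\widehat{\mathcal L}_\sigma(w;(x,w'))=p(u)+q(v)+\hat\phi(w;w')+\langle x,\mathcal A^*u+\mathcal B^*v-c\rangle+\tfrac{\sigma}{2}\|\mathcal A^*u+\mathcal B^*v-c\|^2 .$$ Let $(u^k,v^k,x^k)_{k\ge0}$ be a sequence generated by the majorized ADMM: $(u^0,v^0,x^0)\in\mathrm{dom}(p)\times\mathrm{dom}(q)\times\mathcal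 X$ and, with $w^k=(u^k,v^k)$, for $k\ge 0$, $$u^{k+1}\in\arg\min_{u}\bigl\{\widehat{\mathcal L}_\sigma(u,v^k;(x^k,w^k))+\tfrac12\|u-u^k\|^2_{\mathcal S}\bigr\},\quad v^{k+1}\in\arg\min_{v}\bigl\{\widehat{\mathcal L}_\sigma(u^{k+1},v;(x^k,w^k))+\tfrac12\|v-v^k\|^2_{\mathcal T}\bigr\},$$ $$x^{k+1}=x^k+\tau\sigma(\mathcal A^*u^{k+1}+\mathcal B^*v^{k+1}-c).$$ **Theorem.** Suppose that the solution set of $(P)$ is nonempty, that some $(\hat u,\hat v)\in\mathrm{ri}(\mathrm{dom}(p)\times\mathrm{dom}(q))$ satisfies $\mathcal A^*\hat u+\mathcal B^*\hat v=c$, and that one of the following holds: (i) $\tau\in(0,1]$ and $\mathcal O_1:=\frac14\mathcal Q+\mathrm{Diag}\bigl(\mathcal S+(1-\tau)\sigma\mathcal A\mathcal A^*,\ \mathcal T+(1-\tau)\sigma\mathcal B\mathcal B^*\bigr)\succ0$; (ii) $\tau\in\bigl(0,\frac{1+\sqrt5}{2}\bigr)$, $\ \frac14\mathcal Q+\mathrm{Diag}(\mathcal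 S-\eta\mathcal D_1,\ \mathcal T-\eta\mathcal D_2)\succeq0$ and $\mathcal O_2:=\frac14\mathcal Q+\mathrm{Diag}\bigl(\mathcal S+\sigma\mathcal A\mathcal A^*-\eta\mathcal D_1,\ \mathcal T+\sigma\mathcal B\mathcal B^*-\eta\mathcal D_2\bigr)\succ0$. Let $F(u,v,x)=\nabla\phi(u,v)+\bigl(\partial p(u)+\mathcal Ax,\ \partial q(v)+\mathcal Bx\bigr)$, and let $\mathrm{dist}(0,\cdot)$ denote the distance from $0$ to a set ($+\infty$ for the empty set). Then there is a constant $C$ such that for all $k\ge1$ $$\min_{1\le i\le k}\Bigl\{\mathrm{dist}^2\bigl(0,F(u^{i+1},v^{i+1},x^{i+1})\bigr)+\|\mathcal A^*u^{i+1}+\mathcal B^*v^{i+1}-c\|^2\Bigr\}\le\frac Ck .$$ For fixed $\mathcal A,\mathcal B,\mathcal Q,\mathcal D_1,\mathcal D_2,\mathcal S,\mathcal T,\sigma,\tau,\eta$, this $C$ depends only on the initial point $(u^0,v^0,x^0)$ and on the primal-dual optimal solution set of $(P)$, i.e. the set of $(u,v,x)$ with $0\in F(u,v,x)$ and $\mathcal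 A^*u+\mathcal B^*v=c$. Furthermore, $$\lim_{k\to\infty}k\,\min_{1\le i\le k}\Bigl\{\mathrm{dist}^2\bigl(0,F(u^{i+1},v^{i+1},x^{i+1})\bigr)+\|\mathcal A^*u^{i+1}+\mathcal B^*v^{i+1}-c\|^2\Bigr\}=0 .$$ -/

import Mathlib

open Filter Topology
open scoped NNReal ENNReal InnerProductSpace Gradient

namespace MajorizedADMM

section General

variable {E : Type*} [NormedAddCommGroup E] [InnerProductSpace ℝ E]

/-- The effective domain `dom f` of an extended-real-valued function. -/
def dom (f : E → EReal) : Set E := {z | f z < ⊤}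

/-- `f : E → (-∞, ∞]` is a closed (lower semicontinuous) proper convex function. -/
structure ClosedProperConvex (f : E → EReal) : Prop where
  ne_bot : ∀ z, f z ≠ ⊥
  dom_nonempty : (dom f).Nonempty
  convex_epigraph : Convex ℝ {y : E × ℝ | f y.1 ≤ (y.2 : EReal)}
  lowerSemicontinuous : LowerSemicontinuous f

/-- The convex subdifferential `∂f(z)`. -/
def subdifferential (f : E → EReal) (z : E) : Set E :=
  {ξ | ∀ y, f z + ((⟪ξ, y - z⟫_ℝ : ℝ) : EReal) ≤ f y}

/-- The quadratic form `‖z‖²_G = ⟨z, G z⟩`. -/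
noncomputable def sqNorm (G : E →L[ℝ] E) (z : E) : ℝ := ⟪z, G z⟫_ℝ

/-- `G ≻ 0`: self-adjoint and positive definite (`G ⪰ 0` is Mathlib's `G.IsPositive`). -/
def PosDef (G : E →L[ℝ] E) : Prop :=
  (G : E →ₗ[ℝ] E).IsSymmetric ∧ ∀ z, z ≠ 0 → 0 < ⟪z, G z⟫_ℝ

/-- Clarke's generalized Hessian: the convex hull of all limits of Hessians `∇²φ(wᵏ)`, along
sequences `wᵏ → w` of points where the gradient map is differentiable. -/
noncomputable def genHessian [CompleteSpace E] (φ : E → ℝ) (w : E) : Set (E →L[ℝ] E) :=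
  convexHull ℝ {W | ∃ y : ℕ → E, Tendsto y atTop (𝓝 w) ∧
    (∀ k, DifferentiableAt ℝ (gradient φ) (y k)) ∧
    Tendsto (fun k => fderiv ℝ (gradient φ) (y k)) atTop (𝓝 W)}

/-- The quadratic majorization
`φ̂(w; w') = φ(w') + ⟨∇φ(w'), w - w'⟩ + ½ ‖w' - w‖²_G`, used with `G = Q + H`. -/
noncomputable def majorant [CompleteSpace E] (φ : E → ℝ) (G : E →L[ℝ] E) (w w' : E) : ℝ :=
  φ w' + ⟪gradient φ w', w - w'⟫_ℝ + 1 / 2 * sqNorm G (w' - w)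

end General

variable {U V X : Type*}
  [NormedAddCommGroup U] [InnerProductSpace ℝ U]
  [NormedAddCommGroup V] [InnerProductSpace ℝ V]
  [NormedAddCommGroup X] [InnerProductSpace ℝ X]

/-- The vector `w = (u, v)` in the Euclidean product space `U × V`
(whose inner product is the sum of the inner products of the components). -/
def pair (u : U) (v : V) : WithLp 2 (U × V) := WithLp.toLp 2 (u, v)

/-- The block diagonal operator `Diag(G₁, G₂) : (u, v) ↦ (G₁ u, G₂ v)` on `U × V`. -/
noncomputable def blockDiag (G₁ : U →L[ℝ] U) (G₂ : V →L[ℝ] V) :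
    WithLp 2 (U × V) →L[ℝ] WithLp 2 (U × V) :=
  ((WithLp.prodContinuousLinearEquiv 2 ℝ U V).symm :
      U × V →L[ℝ] WithLp 2 (U × V)) ∘L (G₁.prodMap G₂) ∘L
    (WithLp.prodContinuousLinearEquiv 2 ℝ U V : WithLp 2 (U × V) →L[ℝ] U × V)

theorem blockDiag_pair (G₁ : U →L[ℝ] U) (G₂ : V →L[ℝ] V) (u : U) (v : V) :
    blockDiag G₁ G₂ (pair u v) = pair (G₁ u) (G₂ v) := rfl

/-- The upper right block `W₁₂ : V → U` of an operator `W` on `U × V`. -/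
def block₁₂ (W : WithLp 2 (U × V) →L[ℝ] WithLp 2 (U × V)) (v : V) : U :=
  (W (pair 0 v)).fst

variable [FiniteDimensional ℝ U] [FiniteDimensional ℝ V] [FiniteDimensional ℝ X]

/-- The constraint residual `A* u + B* v - c`. -/
noncomputable def constr (A : X →L[ℝ] U) (B : X →L[ℝ] V) (c : X) (u : U) (v : V) : X :=
  A.adjoint u + B.adjoint v - c

/-- The objective `θ(u, v) = p(u) + q(v) + φ(u, v)`. -/
noncomputable def objective (p : U → EReal) (q : V → EReal) (φ : WithLp 2 (U × V) → ℝ)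
    (u : U) (v : V) : EReal :=
  p u + q v + ((φ (pair u v) : ℝ) : EReal)

/-- The set of optimal solutions of `min θ(u, v)` subject to `A* u + B* v = c`. -/
def solutionSet (p : U → EReal) (q : V → EReal) (φ : WithLp 2 (U × V) → ℝ)
    (A : X →L[ℝ] U) (B : X →L[ℝ] V) (c : X) : Set (U × V) :=
  {z | constr A B c z.1 z.2 = 0 ∧
    ∀ u v, constr A B c u v = 0 → objective p q φ z.1 z.2 ≤ objective p q φ u v}

/-- The constraint qualification: some point of the relative interior of `dom p × dom q`
satisfies the linear constraint. -/
def ConstraintQualification (p : U → EReal) (q : V → EReal)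
    (A : X →L[ℝ] U) (B : X →L[ℝ] V) (c : X) : Prop :=
  ∃ z ∈ intrinsicInterior ℝ (dom p ×ˢ dom q), constr A B c z.1 z.2 = 0

/-- The set-valued map `F(u, v, x) = ∇φ(u, v) + (∂p(u) + A x, ∂q(v) + B x)`. -/
noncomputable def kktMap (p : U → EReal) (q : V → EReal) (φ : WithLp 2 (U × V) → ℝ)
    (A : X →L[ℝ] U) (B : X →L[ℝ] V) (u : U) (v : V) (x : X) : Set (WithLp 2 (U × V)) :=
  {z | ∃ ξ ∈ subdifferential p u, ∃ ζ ∈ subdifferential q v,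
    z = gradient φ (pair u v) + pair (ξ + A x) (ζ + B x)}

/-- The set of primal-dual optimal solutions, that is of KKT points `(u, v, x)`: the optimal
solutions together with their multipliers. -/
def kktSet (p : U → EReal) (q : V → EReal) (φ : WithLp 2 (U × V) → ℝ)
    (A : X →L[ℝ] U) (B : X →L[ℝ] V) (c : X) : Set (U × V × X) :=
  {z | 0 ∈ kktMap p q φ A B z.1 z.2.1 z.2.2 ∧ constr A B c z.1 z.2.1 = 0}

/-- The KKT residual `dist²(0, F(u, v, x)) + ‖A* u + B* v - c‖²`, with `dist(0, ∅) = ∞`. -/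
noncomputable def kktResidual (p : U → EReal) (q : V → EReal) (φ : WithLp 2 (U × V) → ℝ)
    (A : X →L[ℝ] U) (B : X →L[ℝ] V) (c : X) (u : U) (v : V) (x : X) : ℝ≥0∞ :=
  Metric.infEDist 0 (kktMap p q φ A B u v x) ^ 2 + ENNReal.ofReal (‖constr A B c u v‖ ^ 2)

/-- The majorized augmented Lagrangian `L̂_σ(w; (x, w'))` at `w = (u, v)`, where `G = Q + H`. -/
noncomputable def majLagrangian (p : U → EReal) (q : V → EReal) (φ : WithLp 2 (U × V) → ℝ)
    (A : X →L[ℝ] U) (B : X →L[ℝ] V) (c : X)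
    (G : WithLp 2 (U × V) →L[ℝ] WithLp 2 (U × V)) (σ : ℝ)
    (u : U) (v : V) (x : X) (w' : WithLp 2 (U × V)) : EReal :=
  p u + q v + ((majorant φ G (pair u v) w' + ⟪x, constr A B c u v⟫_ℝ
    + σ / 2 * ‖constr A B c u v‖ ^ 2 : ℝ) : EReal)

/-- `(uᵏ, vᵏ, xᵏ)` is generated by the majorized ADMM with penalty parameter `σ`, step length `τ`
and proximal operators `S`, `T`. -/
structure IsMajorizedADMM (p : U → EReal) (q : V → EReal) (φ : WithLp 2 (U × V) → ℝ)
    (A : X →L[ℝ] U) (B : X →L[ℝ] V) (c : X)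
    (G : WithLp 2 (U × V) →L[ℝ] WithLp 2 (U × V)) (S : U →L[ℝ] U) (T : V →L[ℝ] V) (σ τ : ℝ)
    (u : ℕ → U) (v : ℕ → V) (x : ℕ → X) : Prop where
  init_u : u 0 ∈ dom p
  init_v : v 0 ∈ dom q
  step_u : ∀ k, IsMinOn (fun y : U =>
    majLagrangian p q φ A B c G σ y (v k) (x k) (pair (u k) (v k))
      + ((1 / 2 * sqNorm S (y - u k) : ℝ) : EReal)) Set.univ (u (k + 1))
  step_v : ∀ k, IsMinOn (fun y : V =>
    majLagrangian p q φ A B c G σ (u (k + 1)) y (x k) (pair (u k) (v k))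
      + ((1 / 2 * sqNorm T (y - v k) : ℝ) : EReal)) Set.univ (v (k + 1))
  step_x : ∀ k, x (k + 1) = x k + (τ * σ) • constr A B c (u (k + 1)) (v (k + 1))

end MajorizedADMM

open MajorizedADMM

/-! The argument is a Lyapunov estimate around one fixed KKT point. Such a point exists by
`kktSet_nonempty`: linearizing `φ` at an optimal solution leaves a convex problem with affine
constraints, and `exists_multiplier` supplies its multiplier by an extension argument on a cone.

Rademacher's theorem, with averaging over small balls (`inner_sub_le_of_forall_fderiv`), turns the
assumptions on the generalized Hessian into finite-difference bounds on the gradient. Together with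
monotonicity of the subdifferentials these give, for the errors of the iterates, the one-step
inequality of `energy_descent`. Its only troublesome terms are a `Q`-coupling between the two
blocks, handled by `coupled_quadratic_le`, and the product of `B* Δv` with the constraint residual.
For `τ ≤ 1` that product is absorbed by completing a square. For larger `τ` it is traded, through
monotonicity of `∂q` at two consecutive iterates and `coupling_bound`, for a product with the
previous residual carrying the factor `1 - τ`; the resulting quadratic form is nonnegative with room
to spare exactly below the golden ratio.

Positive definiteness of `O₁` or `O₂` then makes squared steps and squared residuals summable, with
a bound linear in the squared initial error. `exists_kktResidual_le` bounds the KKT residual by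
these quantities, and `iInf_Icc_le_and_tendsto` converts summability into the rates `O(1/k)` and
`o(1/k)`. All constants come from the operators alone, so the final one sees the problem only
through the starting point and the KKT set. -/

namespace MajorizedADMM

/-! ### Smooth part: from generalized Hessians to gradient bounds. -/

section General
open MeasureTheory

variable {E : Type*} [NormedAddCommGroup E] [InnerProductSpace ℝ E]

theorem isPositive_inner_comm {G : E →L[ℝ] E} (hG : G.IsPositive) (a b : E) :
    ⟪a, G b⟫_ℝ = ⟪b, G a⟫_ℝ := by
  rw [real_inner_comm]; exact hG.1 b a

theorem sqNorm_nonneg {G : E →L[ℝ] E} (hG : G.IsPositive) (a : E) : 0 ≤ ⟪a, G a⟫_ℝ :=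
  hG.inner_nonneg_right a

theorem two_inner_le {G : E →L[ℝ] E} (hG : G.IsPositive) (a b : E) :
    2 * ⟪a, G b⟫_ℝ ≤ ⟪a, G a⟫_ℝ + ⟪b, G b⟫_ℝ := by
  have := sqNorm_nonneg hG (a - b)
  simp only [map_sub, inner_sub_left, inner_sub_right] at this
  linarith [isPositive_inner_comm hG a b]

theorem sqNorm_le {G : E →L[ℝ] E} (a : E) : ⟪a, G a⟫_ℝ ≤ ‖G‖ * ‖a‖ ^ 2 := by
  have := (real_inner_le_norm a (G a)).trans
    (mul_le_mul_of_nonneg_left (G.le_opNorm a) (norm_nonneg a))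
  linarith

variable [FiniteDimensional ℝ E]

/-- A bound on `⟪ξ, Dg(y) d⟫` at the points of differentiability of a Lipschitz map `g`
passes to finite differences of `g` in the direction `d`. -/
theorem inner_sub_le_of_forall_fderiv {g : E → E} {L : ℝ≥0} (hg : LipschitzWith L g)
    (ξ d : E) (m : ℝ) (h : ∀ y, DifferentiableAt ℝ g y → ⟪ξ, fderiv ℝ g y d⟫_ℝ ≤ m) (w : E) :
    ⟪ξ, g (w + d) - g w⟫_ℝ ≤ m := by
  borelize E
  -- The segment from `w` to `w + d` may miss every point of differentiability. A strict violation
  -- persists on a ball around `w`, and the averages over that ball can be differentiated.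
  by_contra! hlt
  obtain ⟨m', hm, hm'⟩ := exists_between hlt
  have hgc : Continuous g := hg.continuous
  have hev : ∀ᶠ x in 𝓝 w, m' < ⟪ξ, g (x + d) - g x⟫_ℝ := by
    have : Continuous fun x => ⟪ξ, g (x + d) - g x⟫_ℝ := by fun_prop
    exact this.continuousAt.eventually (lt_mem_nhds hm')
  obtain ⟨ε, hε, hball⟩ := Metric.eventually_nhds_iff_ball.1 hev
  set μ : Measure E := (Measure.addHaar : Measure E).restrict (Metric.closedBall w (ε / 2)) with hμ
  have hae : ∀ᵐ y ∂(Measure.addHaar : Measure E), DifferentiableAt ℝ g y := hg.ae_differentiableAt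
  have hint : ∀ f : E → ℝ, Continuous f → Integrable f μ := fun f hf =>
    (hf.continuousOn.integrableOn_compact (isCompact_closedBall w (ε / 2)))
  -- For each fixed `t`, Rademacher and translation invariance make `g` differentiable at `x + t •
  -- d` for almost every `x`; the Lipschitz constant provides the dominating function.
  have key : ∀ t : ℝ, HasDerivAt (fun s : ℝ => ∫ x, ⟪ξ, g (x + s • d)⟫_ℝ ∂μ)
      (∫ x, ⟪ξ, fderiv ℝ g (x + t • d) d⟫_ℝ ∂μ) t ∧
      Integrable (fun x => ⟪ξ, fderiv ℝ g (x + t • d) d⟫_ℝ) μ ∧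
      ∀ᵐ x ∂μ, DifferentiableAt ℝ g (x + t • d) := by
    intro t
    have hdiff : ∀ᵐ x ∂μ, DifferentiableAt ℝ g (x + t • d) := by
      apply ae_restrict_of_ae
      exact (measurePreserving_add_right (Measure.addHaar : Measure E)
        (t • d)).quasiMeasurePreserving.ae hae
    have hmeas : Measurable fun x => ⟪ξ, fderiv ℝ g (x + t • d) d⟫_ℝ := by
      have h1 : Measurable fun y => fderiv ℝ g y d := measurable_fderiv_apply_const ℝ g d
      have h2 : Measurable fun x : E => x + t • d := by fun_prop
      exact (h1.comp h2).const_inner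
    have := hasDerivAt_integral_of_dominated_loc_of_lip (μ := μ) (𝕜 := ℝ)
      (F := fun s x => ⟪ξ, g (x + s • d)⟫_ℝ) (F' := fun x => ⟪ξ, fderiv ℝ g (x + t • d) d⟫_ℝ)
      (x₀ := t) (s := Set.univ) (bound := fun _ => ‖ξ‖ * (L * ‖d‖)) univ_mem
      (Eventually.of_forall fun s => by
        have : Continuous fun x => ⟪ξ, g (x + s • d)⟫_ℝ := by fun_prop
        exact this.aestronglyMeasurable)
      (hint _ (by fun_prop)) hmeas.aestronglyMeasurable
      (Eventually.of_forall fun x => by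
        apply LipschitzOnWith.of_dist_le_mul
        intro s _ s' _
        have h0 : 0 ≤ ‖ξ‖ * (L * ‖d‖) := by positivity
        rw [Real.coe_nnabs, abs_of_nonneg h0, Real.dist_eq, ← inner_sub_right]
        refine (abs_real_inner_le_norm _ _).trans ?_
        rw [mul_assoc]
        gcongr
        have := hg.dist_le_mul (x + s • d) (x + s' • d)
        rw [dist_eq_norm, dist_eq_norm, add_sub_add_left_eq_sub, ← sub_smul, norm_smul] at this
        rw [Real.dist_eq, mul_assoc, mul_comm ‖d‖]
        exact this)
      (hint _ continuous_const)
      (by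
        filter_upwards [hdiff] with x hx
        have h1 : HasDerivAt (fun s : ℝ => x + s • d) d t := by
          simpa using ((hasDerivAt_id t).smul_const d).const_add x
        have h2 := hx.hasFDerivAt.comp_hasDerivAt t h1
        simpa using (hasDerivAt_const t ξ).inner ℝ h2)
    exact ⟨this.2, this.1, hdiff⟩
  have hpos : 0 < (μ Set.univ).toReal := by
    rw [hμ, Measure.restrict_apply_univ]
    exact ENNReal.toReal_pos (Metric.measure_closedBall_pos _ _ (by positivity)).ne'
      (isCompact_closedBall w (ε / 2)).measure_ne_top
  have : IsFiniteMeasure μ := ⟨by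
    rw [hμ, Measure.restrict_apply_univ]
    exact (isCompact_closedBall w (ε / 2)).measure_lt_top⟩
  have hle := image_sub_le_mul_sub_of_deriv_le
    (f := fun s : ℝ => ∫ x, ⟪ξ, g (x + s • d)⟫_ℝ ∂μ) (C := (μ Set.univ).toReal * m)
    (fun t => (key t).1.differentiableAt)
    (fun t => by
      rw [(key t).1.deriv]
      refine (integral_mono_ae (g := fun _ => m) (key t).2.1 (hint _ continuous_const) ?_).trans ?_
      · filter_upwards [(key t).2.2] with x hx using h _ hx
      · simp [Measure.real]) (zero_le_one)
  simp only [one_smul, zero_smul, add_zero, sub_zero, mul_one] at hle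
  rw [← integral_sub (hint _ (by fun_prop)) (hint _ (by fun_prop))] at hle
  have hge : (μ Set.univ).toReal * m' ≤ ∫ x, (⟪ξ, g (x + d)⟫_ℝ - ⟪ξ, g x⟫_ℝ) ∂μ := by
    have : (μ Set.univ).toReal * m' = ∫ _, m' ∂μ := by simp [Measure.real]
    rw [this]
    refine integral_mono_ae (hint _ continuous_const) (hint _ (by fun_prop)) ?_
    filter_upwards [ae_restrict_mem Metric.isClosed_closedBall.measurableSet] with x hx
    rw [← inner_sub_right]
    exact (hball x (Metric.closedBall_subset_ball (by linarith) hx)).le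
  nlinarith

theorem fderiv_gradient_mem_genHessian {φ : E → ℝ} {y : E}
    (hy : DifferentiableAt ℝ (gradient φ) y) : fderiv ℝ (gradient φ) y ∈ genHessian φ y :=
  subset_convexHull _ _ ⟨fun _ => y, tendsto_const_nhds, fun _ => hy, tendsto_const_nhds⟩

theorem PosDef.exists_coercive {G : E →L[ℝ] E} (hG : PosDef G) :
    ∃ m > 0, ∀ z, m * ‖z‖ ^ 2 ≤ ⟪z, G z⟫_ℝ := by
  rcases subsingleton_or_nontrivial E with hE | hE
  · exact ⟨1, one_pos, fun z => by simp [Subsingleton.elim z 0]⟩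
  obtain ⟨z₀, hz₀, hmin⟩ := (isCompact_sphere (0 : E) 1).exists_isMinOn
    (NormedSpace.sphere_nonempty.2 zero_le_one) (f := fun z => ⟪z, G z⟫_ℝ) (by fun_prop)
  have hz₀' : ‖z₀‖ = 1 := by simpa using hz₀
  refine ⟨⟪z₀, G z₀⟫_ℝ, hG.2 z₀ (by rintro rfl; simp at hz₀'), fun z => ?_⟩
  rcases eq_or_ne z 0 with rfl | hz
  · simp
  have hn : ‖z‖ ≠ 0 := norm_ne_zero_iff.2 hz
  have h1 : (‖z‖⁻¹ • z) ∈ Metric.sphere (0 : E) 1 := by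
    simp [norm_smul, inv_mul_cancel₀ hn]
  have h2 : ⟪z₀, G z₀⟫_ℝ ≤ ⟪‖z‖⁻¹ • z, G (‖z‖⁻¹ • z)⟫_ℝ := hmin h1
  rw [map_smul, inner_smul_left, inner_smul_right] at h2
  simp only [conj_trivial] at h2
  calc _ ≤ ‖z‖⁻¹ * (‖z‖⁻¹ * ⟪z, G z⟫_ℝ) * ‖z‖ ^ 2 := by gcongr
    _ = _ := by field_simp

/-- Second-order bounds on a `C^{1,1}` function whose Hessians lie between `Q` and `G`. -/
structure HessianBounds (φ : E → ℝ) (Q G : E →L[ℝ] E) : Prop where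
  le_upper : ∀ w d, φ (w + d) ≤ φ w + ⟪gradient φ w, d⟫_ℝ + 1 / 2 * ⟪d, G d⟫_ℝ
  lower_le : ∀ w d, φ w + ⟪gradient φ w, d⟫_ℝ + 1 / 2 * ⟪d, Q d⟫_ℝ ≤ φ (w + d)

theorem hasDerivAt_along {φ : E → ℝ} (hφ : Differentiable ℝ φ) (w d : E) (t : ℝ) :
    HasDerivAt (fun s : ℝ => φ (w + s • d)) ⟪gradient φ (w + t • d), d⟫_ℝ t := by
  have h1 : HasDerivAt (fun s : ℝ => w + s • d) d t := by
    simpa using ((hasDerivAt_id t).smul_const d).const_add w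
  have h2 := (hφ (w + t • d)).hasGradientAt.hasFDerivAt.comp_hasDerivAt t h1
  simpa [Function.comp_def] using h2

/-- Integration of a one-sided bound on gradient differences along a segment. -/
theorem quadratic_le_of_grad {φ : E → ℝ} (hφ : Differentiable ℝ φ) (ε : ℝ) {w d : E} {b : ℝ}
    (h : ∀ t > 0, t * t * b ≤ ε * ⟪t • d, gradient φ (w + t • d) - gradient φ w⟫_ℝ) :
    ε * (φ w + ⟪gradient φ w, d⟫_ℝ) + 1 / 2 * b ≤ ε * φ (w + d) := by
  let f : ℝ → ℝ := fun t => ε * (φ (w + t • d) - t * ⟪gradient φ w, d⟫_ℝ) - 1 / 2 * t ^ 2 * b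
  have hf : ∀ t, HasDerivAt f
      (ε * (⟪gradient φ (w + t • d), d⟫_ℝ - ⟪gradient φ w, d⟫_ℝ) - t * b) t := by
    intro t
    have h1 := ((hasDerivAt_along hφ w d t).sub
      ((hasDerivAt_id t).mul_const ⟪gradient φ w, d⟫_ℝ)).const_mul ε
    have h2 := (((hasDerivAt_id t).pow 2).const_mul (1 / 2 : ℝ)).mul_const b
    refine (h1.sub h2).congr_deriv ?_
    simp
  have hmono : MonotoneOn f (Set.Icc 0 1) := by
    apply monotoneOn_of_deriv_nonneg (convex_Icc 0 1)
      (fun t _ => (hf t).continuousAt.continuousWithinAt)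
      (fun t _ => (hf t).differentiableAt.differentiableWithinAt)
    intro t ht
    rw [interior_Icc] at ht
    rw [(hf t).deriv]
    have := h t ht.1
    rw [inner_smul_left, inner_sub_right, real_inner_comm _ d, real_inner_comm _ d] at this
    simp only [conj_trivial] at this
    have h3 : t * (t * b) ≤ t * (ε * (⟪gradient φ (w + t • d), d⟫_ℝ - ⟪gradient φ w, d⟫_ℝ)) := by
      linarith
    linarith [le_of_mul_le_mul_left h3 ht.1]
  have := hmono (by simp) (by simp) zero_le_one
  simp only [f, zero_smul, add_zero, one_smul] at this
  linarith

/-- Bounds on `⟪d, ∇φ(w + d) - ∇φ(w)⟫` follow from the Hessian bounds, and integrating them along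
the segment gives the quadratic bounds. The upper one is the lower one for `-φ`, hence the sign `ε =
-1`. -/
theorem HessianBounds.of_genHessian {φ : E → ℝ} {Q G : E →L[ℝ] E} (hφ : Differentiable ℝ φ)
    {L : ℝ≥0} (hL : LipschitzWith L (gradient φ))
    (h : ∀ w, ∀ W ∈ genHessian φ w, (W - Q).IsPositive ∧ (G - W).IsPositive) :
    HessianBounds φ Q G := by
  have h1 : ∀ w d, ⟪d, gradient φ (w + d) - gradient φ w⟫_ℝ ≤ ⟪d, G d⟫_ℝ := by
    intro w d
    apply inner_sub_le_of_forall_fderiv hL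
    intro y hy
    have := sqNorm_nonneg (h y _ (fderiv_gradient_mem_genHessian hy)).2 d
    rw [sub_apply, inner_sub_right] at this
    linarith
  have h2 : ∀ w d, ⟪d, Q d⟫_ℝ ≤ ⟪d, gradient φ (w + d) - gradient φ w⟫_ℝ := by
    intro w d
    have := inner_sub_le_of_forall_fderiv hL (-d) d (- ⟪d, Q d⟫_ℝ) (fun y hy => by
      have := sqNorm_nonneg (h y _ (fderiv_gradient_mem_genHessian hy)).1 d
      rw [sub_apply, inner_sub_right] at this
      rw [inner_neg_left]
      linarith) w
    rw [inner_neg_left] at this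
    linarith
  refine ⟨fun w d => ?_, fun w d => ?_⟩
  · have := quadratic_le_of_grad hφ (-1) (w := w) (d := d) (b := - ⟪d, G d⟫_ℝ) (fun t _ => by
      have := h1 w (t • d)
      rw [map_smul, inner_smul_left _ (t • _), inner_smul_right] at this
      simp only [conj_trivial] at this
      linarith)
    linarith
  · have := quadratic_le_of_grad hφ 1 (w := w) (d := d) (b := ⟪d, Q d⟫_ℝ) (fun t _ => by
      have := h2 w (t • d)
      rw [map_smul, inner_smul_left, inner_smul_right] at this
      simp only [conj_trivial] at this
      linarith)
    linarith

/-- The Lipschitz bound on the gradient coming from `0 ⪯ W ⪯ G`. -/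
theorem norm_gradient_sub_sq_le {φ : E → ℝ} {Q G : E →L[ℝ] E} (hQ : Q.IsPositive)
    {L : ℝ≥0} (hL : LipschitzWith L (gradient φ))
    (h : ∀ w, ∀ W ∈ genHessian φ w, (W - Q).IsPositive ∧ (G - W).IsPositive) (w d : E) :
    ‖gradient φ (w + d) - gradient φ w‖ ^ 2 ≤ ‖G‖ * (‖G‖ + 1) * ‖d‖ ^ 2 := by
  set N := ‖G‖
  have hN : 0 ≤ N := norm_nonneg _
  have h1 : ∀ ξ : E, ⟪ξ, gradient φ (w + d) - gradient φ w⟫_ℝ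
      ≤ 1 / 2 * N * (‖ξ‖ ^ 2 + ‖d‖ ^ 2) := by
    intro ξ
    apply inner_sub_le_of_forall_fderiv hL
    intro y hy
    obtain ⟨hW, hW'⟩ := h y _ (fderiv_gradient_mem_genHessian hy)
    set W := fderiv ℝ (gradient φ) y
    have hWp : W.IsPositive := by simpa using hW.add hQ
    have h2 := two_inner_le hWp ξ d
    have h3 := sqNorm_nonneg hW' ξ
    have h4 := sqNorm_nonneg hW' d
    rw [sub_apply, inner_sub_right] at h3 h4
    have h5 := sqNorm_le (G := G) ξ
    have h6 := sqNorm_le (G := G) d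
    linarith
  set Γ := gradient φ (w + d) - gradient φ w
  -- The scaling `N + 1` avoids a division by zero when `G = 0`. The Lipschitz constant `L` does not
  -- enter the bound, so later constants do not depend on `φ`.
  have h2 := h1 ((N + 1)⁻¹ • Γ)
  rw [inner_smul_left, norm_smul, real_inner_self_eq_norm_sq] at h2
  simp only [conj_trivial, norm_inv, Real.norm_eq_abs,
    abs_of_pos (show 0 < N + 1 by linarith)] at h2
  have h3 : (N + 1) * ((N + 1)⁻¹ * ‖Γ‖ ^ 2) = ‖Γ‖ ^ 2 := by field_simp
  set s := (N + 1)⁻¹ * ‖Γ‖ ^ 2 with hs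
  have h4 : ((N + 1)⁻¹ * ‖Γ‖) ^ 2 = (N + 1)⁻¹ * s := by rw [hs]; ring
  have h5 : N * ((N + 1)⁻¹ * s) ≤ s := by
    have h0 : 0 ≤ s := by positivity
    have : N * (N + 1)⁻¹ ≤ 1 := by
      rw [mul_inv_le_iff₀ (by linarith)]; linarith
    nlinarith
  rw [h4] at h2
  have h6 : s ≤ N * ‖d‖ ^ 2 := by nlinarith
  rw [← h3]
  nlinarith

end General

/-! ### Subdifferentials of closed proper convex functions. -/

section Subdifferential

variable {E : Type*} [NormedAddCommGroup E] [InnerProductSpace ℝ E] {p : E → EReal}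

theorem ClosedProperConvex.coe_toReal (hp : ClosedProperConvex p) {z : E} (hz : p z < ⊤) :
    ((p z).toReal : EReal) = p z :=
  EReal.coe_toReal hz.ne (hp.ne_bot z)

theorem ClosedProperConvex.le_combo (hp : ClosedProperConvex p) {z y : E} (hz : p z < ⊤)
    (hy : p y < ⊤) {t : ℝ} (h0 : 0 ≤ t) (h1 : t ≤ 1) :
    p (z + t • (y - z)) ≤ (((1 - t) * (p z).toReal + t * (p y).toReal : ℝ) : EReal) := by
  have := hp.convex_epigraph (x := (z, (p z).toReal)) (hp.coe_toReal hz).ge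
    (y := (y, (p y).toReal)) (hp.coe_toReal hy).ge (sub_nonneg.2 h1) h0 (by ring)
  simp only [Set.mem_ofPred_eq, Prod.smul_mk, Prod.mk_add_mk, smul_eq_mul] at this
  convert this using 2
  module

theorem ClosedProperConvex.mem_subdifferential_iff (hp : ClosedProperConvex p) {z ξ : E}
    (hz : p z < ⊤) : ξ ∈ subdifferential p z ↔
      ∀ y, p y < ⊤ → (p z).toReal + ⟪ξ, y - z⟫_ℝ ≤ (p y).toReal := by
  refine forall_congr' fun y => ⟨fun h hy => ?_, fun h => ?_⟩
  · rw [← hp.coe_toReal hz, ← hp.coe_toReal hy] at h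
    exact_mod_cast h
  · rcases lt_or_eq_of_le (le_top : p y ≤ ⊤) with hy | hy
    · rw [← hp.coe_toReal hz, ← hp.coe_toReal hy]
      exact_mod_cast h hy
    · rw [hy]; exact le_top

theorem ClosedProperConvex.lt_top_of_mem_subdifferential (hp : ClosedProperConvex p) {z ξ : E}
    (h : ξ ∈ subdifferential p z) : p z < ⊤ := by
  obtain ⟨y, hy⟩ := hp.dom_nonempty
  by_contra hz
  have h1 := h y
  rw [not_lt_top_iff.1 hz, EReal.top_add_coe] at h1
  exact absurd hy (not_lt.2 h1)

theorem ClosedProperConvex.subdifferential_monotone (hp : ClosedProperConvex p) {z z' ξ ξ' : E}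
    (h : ξ ∈ subdifferential p z) (h' : ξ' ∈ subdifferential p z') :
    0 ≤ ⟪ξ - ξ', z - z'⟫_ℝ := by
  have hz := hp.lt_top_of_mem_subdifferential h
  have hz' := hp.lt_top_of_mem_subdifferential h'
  have h1 := (hp.mem_subdifferential_iff hz).1 h _ hz'
  have h2 := (hp.mem_subdifferential_iff hz').1 h' _ hz
  simp only [inner_sub_right, inner_sub_left] at *
  linarith

/-- For small `t` the linear term dominates. This replaces directional derivatives in the optimality
conditions. -/
theorem nonneg_of_forall_quadratic {a m : ℝ} (h : ∀ t, 0 < t → t ≤ 1 → 0 ≤ t * a + t ^ 2 * m) :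
    0 ≤ a := by
  by_contra! ha
  have hm : 0 < |m| + 1 := by positivity
  obtain ⟨t, ht, ht1, ht2⟩ : ∃ t, 0 < t ∧ t ≤ 1 ∧ t * |m| < -a := by
    refine ⟨min 1 (-a / (2 * (|m| + 1))), by positivity [neg_pos.2 ha], min_le_left _ _, ?_⟩
    calc _ ≤ -a / (2 * (|m| + 1)) * |m| := by gcongr; exact min_le_right _ _
      _ < -a := by
        rw [div_mul_eq_mul_div, div_lt_iff₀ (by positivity)]
        nlinarith [abs_nonneg m]
  have h1 := h t ht ht1
  have h2 : t * (a + t * m) < 0 := by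
    apply mul_neg_of_pos_of_neg ht
    have : t * m ≤ t * |m| := by gcongr; exact le_abs_self m
    linarith
  nlinarith

/-- First-order condition for minimizing a convex function plus a function with a quadratic
expansion at the minimizer. -/
theorem ClosedProperConvex.mem_subdifferential_of_min (hp : ClosedProperConvex p) {z ξ : E}
    (hz : p z < ⊤) (h : E → ℝ) (hmin : ∀ y, p z + (h z : EReal) ≤ p y + (h y : EReal))
    (hq : ∀ d, ∃ m : ℝ, ∀ t : ℝ, h (z + t • d) = h z + t * ⟪-ξ, d⟫_ℝ + t ^ 2 * m) :
    ξ ∈ subdifferential p z := by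
  rw [hp.mem_subdifferential_iff hz]
  intro y hy
  obtain ⟨m, hm⟩ := hq (y - z)
  have := nonneg_of_forall_quadratic (a := (p y).toReal - (p z).toReal - ⟪ξ, y - z⟫_ℝ) (m := m) (by
    intro t ht ht1
    have h1 := hp.le_combo hz hy ht.le ht1
    have h2 := (hmin (z + t • (y - z))).trans (add_le_add_left h1 _)
    rw [← hp.coe_toReal hz, hm] at h2
    have h3 : (p z).toReal + h z ≤ ((1 - t) * (p z).toReal + t * (p y).toReal)
      + (h z + t * ⟪-ξ, y - z⟫_ℝ + t ^ 2 * m) := by exact_mod_cast h2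
    rw [inner_neg_left] at h3
    linarith)
  linarith

end Subdifferential

/-! ### Algebra of pairs. -/

section Pair

variable {U V : Type*} [NormedAddCommGroup U] [NormedAddCommGroup V]

theorem pair_add (u u' : U) (v v' : V) : pair (u + u') (v + v') = pair u v + pair u' v' := rfl

theorem pair_sub (u u' : U) (v v' : V) : pair (u - u') (v - v') = pair u v - pair u' v' := rfl

theorem pair_eq_add (u : U) (v : V) : pair u v = pair u 0 + pair 0 v := by
  rw [← pair_add]; simp

end Pair

/-! ### Optimality conditions of the subproblems and the coupling of consecutive steps. -/

section Iterates

variable {U V X : Type*}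
  [NormedAddCommGroup U] [InnerProductSpace ℝ U]
  [NormedAddCommGroup V] [InnerProductSpace ℝ V]
  [NormedAddCommGroup X] [InnerProductSpace ℝ X]

theorem inner_pair (u u' : U) (v v' : V) :
    ⟪pair u v, pair u' v'⟫_ℝ = ⟪u, u'⟫_ℝ + ⟪v, v'⟫_ℝ := by
  simp [pair, WithLp.prod_inner_apply]

theorem inner_fst_eq (z : WithLp 2 (U × V)) (u : U) : ⟪z.fst, u⟫_ℝ = ⟪z, pair u 0⟫_ℝ := by
  simp [pair, WithLp.prod_inner_apply]

theorem inner_snd_eq (z : WithLp 2 (U × V)) (v : V) : ⟪z.snd, v⟫_ℝ = ⟪z, pair 0 v⟫_ℝ := by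
  simp [pair, WithLp.prod_inner_apply]

theorem pair_smul (t : ℝ) (u : U) (v : V) : pair (t • u) (t • v) = t • pair u v := rfl

theorem norm_pair_sq (u : U) (v : V) : ‖pair u v‖ ^ 2 = ‖u‖ ^ 2 + ‖v‖ ^ 2 := by
  rw [← real_inner_self_eq_norm_sq, inner_pair, real_inner_self_eq_norm_sq,
    real_inner_self_eq_norm_sq]

theorem norm_fst_le (z : WithLp 2 (U × V)) : ‖z.fst‖ ≤ ‖z‖ := by
  have h : ‖pair z.fst z.snd‖ ^ 2 = ‖z.fst‖ ^ 2 + ‖z.snd‖ ^ 2 := norm_pair_sq _ _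
  have h' : ‖pair z.fst z.snd‖ = ‖z‖ := rfl
  rw [h'] at h
  exact le_of_sq_le_sq (by nlinarith [sq_nonneg ‖z.snd‖]) (norm_nonneg _)

theorem norm_snd_le (z : WithLp 2 (U × V)) : ‖z.snd‖ ≤ ‖z‖ := by
  have h : ‖pair z.fst z.snd‖ ^ 2 = ‖z.fst‖ ^ 2 + ‖z.snd‖ ^ 2 := norm_pair_sq _ _
  have h' : ‖pair z.fst z.snd‖ = ‖z‖ := rfl
  rw [h'] at h
  exact le_of_sq_le_sq (by nlinarith [sq_nonneg ‖z.fst‖]) (norm_nonneg _)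

theorem blockDiag_isPositive {D₁ : U →L[ℝ] U} {D₂ : V →L[ℝ] V} (h₁ : D₁.IsPositive)
    (h₂ : D₂.IsPositive) : (blockDiag D₁ D₂).IsPositive := by
  rw [ContinuousLinearMap.isPositive_iff]
  refine ⟨fun a b => ?_, fun a => ?_⟩
  · change ⟪pair (D₁ a.fst) (D₂ a.snd), pair b.fst b.snd⟫_ℝ
      = ⟪pair a.fst a.snd, pair (D₁ b.fst) (D₂ b.snd)⟫_ℝ
    rw [inner_pair, inner_pair]
    exact congrArg₂ (· + ·) (h₁.1 _ _) (h₂.1 _ _)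
  · change 0 ≤ ⟪pair (D₁ a.fst) (D₂ a.snd), pair a.fst a.snd⟫_ℝ
    rw [inner_pair]
    exact add_nonneg (h₁.inner_nonneg_left _) (h₂.inner_nonneg_left _)

variable [FiniteDimensional ℝ U] [FiniteDimensional ℝ V] [FiniteDimensional ℝ X]
  {p : U → EReal} {q : V → EReal} {φ : WithLp 2 (U × V) → ℝ}
  {A : X →L[ℝ] U} {B : X →L[ℝ] V} {c : X}
  {G : WithLp 2 (U × V) →L[ℝ] WithLp 2 (U × V)} {S : U →L[ℝ] U} {T : V →L[ℝ] V} {σ τ : ℝ}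
  {u : ℕ → U} {v : ℕ → V} {x : ℕ → X}

theorem majLagrangian_add_eq (u : U) (v : V) (x : X) (w' : WithLp 2 (U × V)) (s : ℝ) :
    majLagrangian p q φ A B c G σ u v x w' + (s : EReal) =
      p u + q v + ((majorant φ G (pair u v) w' + ⟪x, constr A B c u v⟫_ℝ
        + σ / 2 * ‖constr A B c u v‖ ^ 2 + s : ℝ) : EReal) := by
  rw [majLagrangian, add_assoc, ← EReal.coe_add]

/-- The previous iterate is a competitor with finite value, so a minimizer cannot have value `⊤`. -/
theorem IsMajorizedADMM.mem_dom (hp : ClosedProperConvex p) (hq : ClosedProperConvex q)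
    (h : IsMajorizedADMM p q φ A B c G S T σ τ u v x) (k : ℕ) : p (u k) < ⊤ ∧ q (v k) < ⊤ := by
  induction k with
  | zero => exact ⟨h.init_u, h.init_v⟩
  | succ k ih =>
    have hu : p (u (k + 1)) < ⊤ := by
      have h1 := h.step_u k (Set.mem_univ (u k))
      simp only [Set.mem_ofPred_eq, majLagrangian_add_eq] at h1
      by_contra hne
      rw [not_lt_top_iff.1 hne, EReal.top_add_of_ne_bot (hq.ne_bot _), EReal.top_add_coe,
        ← hp.coe_toReal ih.1, ← hq.coe_toReal ih.2, ← EReal.coe_add, ← EReal.coe_add] at h1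
      exact EReal.coe_ne_top _ (top_le_iff.1 h1)
    refine ⟨hu, ?_⟩
    have h1 := h.step_v k (Set.mem_univ (v k))
    simp only [Set.mem_ofPred_eq, majLagrangian_add_eq] at h1
    by_contra hne
    rw [not_lt_top_iff.1 hne, EReal.add_top_of_ne_bot (hp.ne_bot _), EReal.top_add_coe,
      ← hp.coe_toReal hu, ← hq.coe_toReal ih.2, ← EReal.coe_add, ← EReal.coe_add] at h1
    exact EReal.coe_ne_top _ (top_le_iff.1 h1)

theorem constr_add_left (u d : U) (v : V) (t : ℝ) :
    constr A B c (u + t • d) v = constr A B c u v + t • A.adjoint d := by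
  simp only [constr, map_add, map_smul]; abel

theorem constr_add_right (u : U) (v d : V) (t : ℝ) :
    constr A B c u (v + t • d) = constr A B c u v + t • B.adjoint d := by
  simp only [constr, map_add, map_smul]; abel

theorem sqNorm_add_smul {E : Type*} [NormedAddCommGroup E] [InnerProductSpace ℝ E]
    {G : E →L[ℝ] E} (hG : G.IsPositive) (a d : E) (t : ℝ) :
    sqNorm G (a + t • d) = sqNorm G a + t * (2 * ⟪G a, d⟫_ℝ) + t ^ 2 * sqNorm G d := by
  simp only [sqNorm, map_add, map_smul, inner_add_left, inner_add_right, inner_smul_left,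
    inner_smul_right, conj_trivial]
  rw [isPositive_inner_comm hG a d, real_inner_comm d (G a)]
  ring

theorem sqNorm_sub_comm {E : Type*} [NormedAddCommGroup E] [InnerProductSpace ℝ E]
    (G : E →L[ℝ] E) (a b : E) : sqNorm G (a - b) = sqNorm G (b - a) := by
  rw [← neg_sub, sqNorm, map_neg, inner_neg_neg, sqNorm]

theorem norm_add_smul_sq {E : Type*} [NormedAddCommGroup E] [InnerProductSpace ℝ E] (a d : E)
    (t : ℝ) : ‖a + t • d‖ ^ 2 = ‖a‖ ^ 2 + t * (2 * ⟪a, d⟫_ℝ) + t ^ 2 * ‖d‖ ^ 2 := by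
  rw [norm_add_sq_real, inner_smul_right, norm_smul, mul_pow, Real.norm_eq_abs, sq_abs]
  ring

theorem majorant_add_smul (hG : G.IsPositive) (w w' d : WithLp 2 (U × V)) (t : ℝ) :
    majorant φ G (w + t • d) w' = majorant φ G w w' +
      t * ⟪gradient φ w' + G (w - w'), d⟫_ℝ + t ^ 2 * (1 / 2 * sqNorm G d) := by
  have h1 : w + t • d - w' = (w - w') + t • d := by abel
  rw [majorant, majorant, sqNorm_sub_comm, h1, sqNorm_add_smul hG, sqNorm_sub_comm G w' w,
    inner_add_right, inner_smul_right, inner_add_left]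
  ring

/-- First-order condition of the `u`-step. The second block is still `v k`, hence the zero in the
pair and the intermediate residual. -/
theorem IsMajorizedADMM.subgrad_u (hp : ClosedProperConvex p) (hq : ClosedProperConvex q)
    (hG : G.IsPositive) (hS : S.IsPositive)
    (h : IsMajorizedADMM p q φ A B c G S T σ τ u v x) (k : ℕ) :
    -((gradient φ (pair (u k) (v k)) + G (pair (u (k + 1) - u k) 0)).fst
      + A (x k + σ • constr A B c (u (k + 1)) (v k)) + S (u (k + 1) - u k))
      ∈ subdifferential p (u (k + 1)) := by
  have hd := h.mem_dom hp hq
  refine hp.mem_subdifferential_of_min (hd (k + 1)).1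
    (fun y => (q (v k)).toReal + (majorant φ G (pair y (v k)) (pair (u k) (v k))
      + ⟪x k, constr A B c y (v k)⟫_ℝ + σ / 2 * ‖constr A B c y (v k)‖ ^ 2
      + 1 / 2 * sqNorm S (y - u k))) (fun y => ?_) (fun d => ?_)
  · have h1 := h.step_u k (Set.mem_univ y)
    simp only [Set.mem_ofPred_eq, majLagrangian_add_eq] at h1
    rwa [EReal.coe_add (q _).toReal, EReal.coe_add (q _).toReal, hq.coe_toReal (hd k).2,
      ← add_assoc, ← add_assoc]
  · refine ⟨1 / 2 * sqNorm G (pair d 0) + σ / 2 * ‖A.adjoint d‖ ^ 2 + 1 / 2 * sqNorm S d,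
      fun t => ?_⟩
    have h1 : pair (u (k + 1) + t • d) (v k) = pair (u (k + 1)) (v k) + t • pair d 0 := by
      rw [← pair_smul, ← pair_add]; simp
    have h2 : u (k + 1) + t • d - u k = (u (k + 1) - u k) + t • d := by abel
    have h3 : pair (u (k + 1)) (v k) - pair (u k) (v k) = pair (u (k + 1) - u k) 0 := by
      rw [← pair_sub]; simp
    simp only [h1, h2, h3, constr_add_left, majorant_add_smul hG, sqNorm_add_smul hS,
      norm_add_smul_sq, neg_neg]
    simp only [inner_add_left, inner_add_right, inner_smul_right, WithLp.add_fst, map_add,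
      map_smul, inner_smul_left, inner_fst_eq, ContinuousLinearMap.adjoint_inner_right,
      conj_trivial]
    ring

theorem IsMajorizedADMM.subgrad_v (hp : ClosedProperConvex p) (hq : ClosedProperConvex q)
    (hG : G.IsPositive) (hT : T.IsPositive)
    (h : IsMajorizedADMM p q φ A B c G S T σ τ u v x) (k : ℕ) :
    -((gradient φ (pair (u k) (v k)) + G (pair (u (k + 1) - u k) (v (k + 1) - v k))).snd
      + B (x k + σ • constr A B c (u (k + 1)) (v (k + 1))) + T (v (k + 1) - v k))
      ∈ subdifferential q (v (k + 1)) := by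
  have hd := h.mem_dom hp hq
  refine hq.mem_subdifferential_of_min (hd (k + 1)).2
    (fun y => (p (u (k + 1))).toReal + (majorant φ G (pair (u (k + 1)) y) (pair (u k) (v k))
      + ⟪x k, constr A B c (u (k + 1)) y⟫_ℝ + σ / 2 * ‖constr A B c (u (k + 1)) y‖ ^ 2
      + 1 / 2 * sqNorm T (y - v k))) (fun y => ?_) (fun d => ?_)
  · have h1 := h.step_v k (Set.mem_univ y)
    simp only [Set.mem_ofPred_eq, majLagrangian_add_eq] at h1
    rwa [EReal.coe_add (p _).toReal, EReal.coe_add (p _).toReal, hp.coe_toReal (hd (k + 1)).1,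
      ← add_assoc, ← add_assoc, add_comm (q _), add_comm (q _)]
  · refine ⟨1 / 2 * sqNorm G (pair 0 d) + σ / 2 * ‖B.adjoint d‖ ^ 2 + 1 / 2 * sqNorm T d,
      fun t => ?_⟩
    have h1 : pair (u (k + 1)) (v (k + 1) + t • d)
        = pair (u (k + 1)) (v (k + 1)) + t • pair 0 d := by
      rw [← pair_smul, ← pair_add]; simp
    have h2 : v (k + 1) + t • d - v k = (v (k + 1) - v k) + t • d := by abel
    simp only [h1, h2, ← pair_sub, constr_add_right, majorant_add_smul hG, sqNorm_add_smul hT,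
      norm_add_smul_sq, neg_neg]
    simp only [inner_add_left, inner_add_right, inner_smul_right, WithLp.add_snd, map_add,
      map_smul, inner_smul_left, inner_snd_eq, ContinuousLinearMap.adjoint_inner_right,
      conj_trivial]
    ring

/-- The bound on the coupling between consecutive steps that follows from the condition on the
off-diagonal blocks of the generalized Hessians. -/
theorem coupling_bound {Q : WithLp 2 (U × V) →L[ℝ] WithLp 2 (U × V)}
    {D₁ : U →L[ℝ] U} {D₂ : V →L[ℝ] V} {η : ℝ}
    {L : ℝ≥0} (hL : LipschitzWith L (gradient φ))
    (h : ∀ w, ∀ W ∈ genHessian φ w,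
      (W - Q).IsPositive ∧ (Q + blockDiag D₁ D₂ - W).IsPositive)
    (hη : ∀ w, ∀ W ∈ genHessian φ w, ∀ (u : U) (v : V),
      |⟪u, block₁₂ W v - block₁₂ Q v⟫_ℝ| ≤ η / 2 * (sqNorm D₁ u + sqNorm D₂ v))
    (w : WithLp 2 (U × V)) (a : U) (b y : V) :
    -⟪pair 0 y, gradient φ (w + pair a b) - gradient φ w - Q (pair a b)⟫_ℝ + ⟪y, D₂ b⟫_ℝ
      ≤ η / 2 * (sqNorm D₁ a + sqNorm D₂ y) + 1 / 2 * (sqNorm D₂ b + sqNorm D₂ y) := by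
  have := inner_sub_le_of_forall_fderiv hL (-pair 0 y) (pair a b)
    (η / 2 * (sqNorm D₁ a + sqNorm D₂ y) + 1 / 2 * (sqNorm D₂ b + sqNorm D₂ y)
      - ⟪y, D₂ b⟫_ℝ - ⟪pair 0 y, Q (pair a b)⟫_ℝ) (fun z hz => by
      have hmem := fderiv_gradient_mem_genHessian hz
      set W := fderiv ℝ (gradient φ) z
      obtain ⟨h1, h2⟩ := h z W hmem
      have h3 := (abs_le.1 (hη z W hmem a y)).1
      -- Self-adjointness of `W - Q` moves the hypothesis from the upper right block to the lower
      -- left one.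
      have e1 : ⟪a, block₁₂ W y - block₁₂ Q y⟫_ℝ = ⟪pair 0 y, (W - Q) (pair a 0)⟫_ℝ := by
        rw [isPositive_inner_comm h1, real_inner_comm, real_inner_comm _ (pair a 0)]
        exact inner_fst_eq ((W - Q) (pair 0 y)) a
      -- The diagonal contribution is a Young inequality for `Q + H - W`, whose form on `V` is at
      -- most that of `D₂` because `W ⪰ Q`.
      have h4 := two_inner_le h2 (pair 0 y) (pair 0 b)
      have h5 := sqNorm_nonneg h1 (pair 0 y)
      have h6 := sqNorm_nonneg h1 (pair 0 b)
      rw [pair_eq_add a b]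
      rw [e1] at h3
      simp only [sub_apply, add_apply, blockDiag_pair, inner_add_right, inner_sub_right, map_add,
        inner_pair, inner_neg_left, inner_zero_left, sqNorm] at *
      linarith) w
  simp only [inner_sub_right, inner_neg_left] at *
  linarith

end Iterates

/-! ### The energy of the error and its one-step descent. -/

section Energy

variable {U V X : Type*}
  [NormedAddCommGroup U] [InnerProductSpace ℝ U]
  [NormedAddCommGroup V] [InnerProductSpace ℝ V]
  [NormedAddCommGroup X] [InnerProductSpace ℝ X]

theorem sqNorm_add {E : Type*} [NormedAddCommGroup E] [InnerProductSpace ℝ E]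
    {G : E →L[ℝ] E} (hG : G.IsPositive) (a b : E) :
    sqNorm G (a + b) = sqNorm G a + 2 * ⟪a, G b⟫_ℝ + sqNorm G b := by
  simp only [sqNorm, map_add, inner_add_left, inner_add_right]
  linarith [isPositive_inner_comm hG a b]

theorem sqNorm_sub {E : Type*} [NormedAddCommGroup E] [InnerProductSpace ℝ E]
    {G : E →L[ℝ] E} (hG : G.IsPositive) (a b : E) :
    sqNorm G (a - b) = sqNorm G a - 2 * ⟪a, G b⟫_ℝ + sqNorm G b := by
  simp only [sqNorm, map_sub, inner_sub_left, inner_sub_right]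
  linarith [isPositive_inner_comm hG a b]

/-- The difference of the two sides is `‖g - f‖²_Q + ¼ ‖f + e‖²_Q`. The parallelogram identity
behind it is the source of the `¼ Q` in `O₁` and `O₂`. -/
theorem coupled_quadratic_le {E : Type*} [NormedAddCommGroup E] [InnerProductSpace ℝ E]
    {Q : E →L[ℝ] E} (hQ : Q.IsPositive) (e f g : E) :
    1 / 2 * sqNorm Q f - 1 / 2 * sqNorm Q e + 1 / 4 * sqNorm Q (f - e)
      ≤ 2 * sqNorm Q f - 2 * ⟪g, Q f⟫_ℝ + sqNorm Q g := by
  have h1 : 0 ≤ sqNorm Q (f + e) := sqNorm_nonneg hQ _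
  have h2 : 0 ≤ sqNorm Q (g - f) := sqNorm_nonneg hQ _
  rw [sqNorm_add hQ] at h1
  rw [sqNorm_sub hQ] at h2 ⊢
  linarith

/-- The extra inner product is the one contributed by the coupling of consecutive steps. It turns
`⟪g, Q f⟫` into `⟪g, Q e⟫`, at the price of the telescoping weight `3/2`; the slack is `‖g - e‖²_Q +
¼ ‖f + e‖²_Q`. -/
theorem coupled_quadratic_le' {E : Type*} [NormedAddCommGroup E] [InnerProductSpace ℝ E]
    {Q : E →L[ℝ] E} (hQ : Q.IsPositive) (e f g : E) :
    3 / 2 * sqNorm Q f - 3 / 2 * sqNorm Q e + 1 / 4 * sqNorm Q (f - e)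
      ≤ 2 * sqNorm Q f - 2 * ⟪g, Q f⟫_ℝ + sqNorm Q g + 2 * ⟪g, Q (f - e)⟫_ℝ := by
  have h1 : 0 ≤ sqNorm Q (f + e) := sqNorm_nonneg hQ _
  have h2 : 0 ≤ sqNorm Q (g - e) := sqNorm_nonneg hQ _
  rw [sqNorm_add hQ] at h1
  rw [sqNorm_sub hQ] at h2 ⊢
  rw [map_sub, inner_sub_right]
  linarith

/-- The squared length of the error. -/
noncomputable def errSq (a : U) (b : V) (y : X) : ℝ := ‖a‖ ^ 2 + ‖b‖ ^ 2 + ‖y‖ ^ 2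

variable [FiniteDimensional ℝ V] [FiniteDimensional ℝ X]

/-- The part of the Lyapunov function of the error `(a, b, y)` without the coupling term
`‖(a, b)‖²_Q`. -/
noncomputable def energy (B : X →L[ℝ] V) (Q : WithLp 2 (U × V) →L[ℝ] WithLp 2 (U × V))
    (D₁ S : U →L[ℝ] U) (D₂ T : V →L[ℝ] V) (σ τ : ℝ) (a : U) (b : V) (y : X) : ℝ :=
  sqNorm D₁ a + sqNorm S a + sqNorm D₂ b + sqNorm T b + sqNorm Q (pair 0 b)
    + σ * ‖B.adjoint b‖ ^ 2 + (τ * σ)⁻¹ * ‖y‖ ^ 2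

variable {B : X →L[ℝ] V} {Q : WithLp 2 (U × V) →L[ℝ] WithLp 2 (U × V)}
    {D₁ S : U →L[ℝ] U} {D₂ T : V →L[ℝ] V} {σ τ : ℝ}

theorem energy_nonneg (hQ : Q.IsPositive) (hD₁ : D₁.IsPositive) (hD₂ : D₂.IsPositive)
    (hS : S.IsPositive) (hT : T.IsPositive) (hσ : 0 < σ) (hτ : 0 < τ) (a : U) (b : V) (y : X) :
    0 ≤ energy B Q D₁ S D₂ T σ τ a b y := by
  have f1 : 0 ≤ sqNorm D₁ a := sqNorm_nonneg hD₁ _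
  have f2 : 0 ≤ sqNorm S a := sqNorm_nonneg hS _
  have f3 : 0 ≤ sqNorm D₂ b := sqNorm_nonneg hD₂ _
  have f4 : 0 ≤ sqNorm T b := sqNorm_nonneg hT _
  have f5 : 0 ≤ sqNorm Q (pair 0 b) := sqNorm_nonneg hQ _
  unfold energy
  positivity

theorem le_energy (hQ : Q.IsPositive) (hD₁ : D₁.IsPositive) (hD₂ : D₂.IsPositive)
    (hS : S.IsPositive) (hT : T.IsPositive) (hσ : 0 < σ) (hτ : 0 < τ) (a : U) (b : V) (y : X) :
    sqNorm D₁ a ≤ energy B Q D₁ S D₂ T σ τ a b y ∧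
      sqNorm D₂ b + sqNorm T b ≤ energy B Q D₁ S D₂ T σ τ a b y := by
  have f1 : 0 ≤ sqNorm D₁ a := sqNorm_nonneg hD₁ _
  have f2 : 0 ≤ sqNorm S a := sqNorm_nonneg hS _
  have f3 : 0 ≤ sqNorm D₂ b := sqNorm_nonneg hD₂ _
  have f4 : 0 ≤ sqNorm T b := sqNorm_nonneg hT _
  have f5 : 0 ≤ sqNorm Q (pair 0 b) := sqNorm_nonneg hQ _
  have f6 : 0 ≤ σ * ‖B.adjoint b‖ ^ 2 := by positivity
  have f7 : 0 ≤ (τ * σ)⁻¹ * ‖y‖ ^ 2 := by positivity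
  unfold energy
  constructor <;> linarith

theorem exists_initial_bound (B : X →L[ℝ] V) (Q : WithLp 2 (U × V) →L[ℝ] WithLp 2 (U × V))
    (D₁ S : U →L[ℝ] U) (D₂ T : V →L[ℝ] V) (hσ : 0 < σ) (hτ : 0 < τ) :
    ∃ M, 0 ≤ M ∧ ∀ (a : U) (b : V) (y : X),
      1 / 2 * sqNorm Q (pair a b) + energy B Q D₁ S D₂ T σ τ a b y + 2 / σ * ‖y‖ ^ 2
        ≤ M * errSq a b y := by
  refine ⟨2 * ‖Q‖ + ‖D₁‖ + ‖S‖ + ‖D₂‖ + ‖T‖ + σ * ‖B.adjoint‖ ^ 2 + (τ * σ)⁻¹ + 2 / σ,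
    by positivity, fun a b y => ?_⟩
  have h1 := sqNorm_le (G := Q) (pair a b)
  have h2 := sqNorm_le (G := Q) (pair (0 : U) b)
  have h3 := sqNorm_le (G := D₁) a
  have h4 := sqNorm_le (G := S) a
  have h5 := sqNorm_le (G := D₂) b
  have h6 := sqNorm_le (G := T) b
  have h7 : σ * ‖B.adjoint b‖ ^ 2 ≤ σ * (‖B.adjoint‖ * ‖b‖) ^ 2 := by
    gcongr; exact B.adjoint.le_opNorm b
  rw [norm_pair_sq] at h1 h2
  rw [mul_pow] at h7
  have ha : ‖a‖ ^ 2 ≤ errSq a b y := by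
    have := sq_nonneg ‖b‖; have := sq_nonneg ‖y‖; unfold errSq; linarith
  have hb : ‖b‖ ^ 2 ≤ errSq a b y := by
    have := sq_nonneg ‖a‖; have := sq_nonneg ‖y‖; unfold errSq; linarith
  have hy : ‖y‖ ^ 2 ≤ errSq a b y := by
    have := sq_nonneg ‖b‖; have := sq_nonneg ‖a‖; unfold errSq; linarith
  have hab : ‖a‖ ^ 2 + ‖b‖ ^ 2 ≤ errSq a b y := by
    have := sq_nonneg ‖y‖; unfold errSq; linarith
  have k1 := mul_le_mul_of_nonneg_left hab (norm_nonneg Q)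
  have k2 := mul_le_mul_of_nonneg_left hb (norm_nonneg Q)
  have k3 := mul_le_mul_of_nonneg_left ha (norm_nonneg D₁)
  have k4 := mul_le_mul_of_nonneg_left ha (norm_nonneg S)
  have k5 := mul_le_mul_of_nonneg_left hb (norm_nonneg D₂)
  have k6 := mul_le_mul_of_nonneg_left hb (norm_nonneg T)
  have k7 := mul_le_mul_of_nonneg_left hb (show 0 ≤ σ * ‖B.adjoint‖ ^ 2 by positivity)
  have k8 := mul_le_mul_of_nonneg_left hy (show 0 ≤ (τ * σ)⁻¹ by positivity)
  have k9 := mul_le_mul_of_nonneg_left hy (show 0 ≤ 2 / σ by positivity)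
  have k10 := mul_nonneg (norm_nonneg Q) ((sq_nonneg ‖a‖).trans ha)
  simp only [norm_zero, ne_eq, OfNat.ofNat_ne_zero, not_false_eq_true, zero_pow, zero_add] at h2
  simp only [energy]
  simp only [sqNorm]
  linarith

variable [FiniteDimensional ℝ U] {A : X →L[ℝ] U} {η : ℝ}

/-- The basic descent estimate, from the monotonicity of the subdifferentials. -/
theorem energy_descent (hQ : Q.IsPositive) (hD₁ : D₁.IsPositive) (hD₂ : D₂.IsPositive)
    (hS : S.IsPositive) (hT : T.IsPositive) (hσ : 0 < σ) (hτ : 0 < τ)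
    {a a' : U} {b b' : V} {y y' : X} {γ : WithLp 2 (U × V)}
    (hy : y' = y + (τ * σ) • (A.adjoint a' + B.adjoint b'))
    (h₁ : 0 ≤ -⟪γ + (Q + blockDiag D₁ D₂) (pair (a' - a) 0), pair a' 0⟫_ℝ
      - ⟪y + σ • (A.adjoint a' + B.adjoint b), A.adjoint a'⟫_ℝ - ⟪S (a' - a), a'⟫_ℝ)
    (h₂ : 0 ≤ -⟪γ + (Q + blockDiag D₁ D₂) (pair (a' - a) (b' - b)), pair 0 b'⟫_ℝ
      - ⟪y + σ • (A.adjoint a' + B.adjoint b'), B.adjoint b'⟫_ℝ - ⟪T (b' - b), b'⟫_ℝ)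
    (h₃ : -⟪γ, pair a' b'⟫_ℝ ≤ 1 / 2 * sqNorm (Q + blockDiag D₁ D₂) (pair (a' - a) (b' - b))
      - 1 / 2 * sqNorm Q (pair a b) - 1 / 2 * sqNorm Q (pair a' b')) :
    2 * sqNorm Q (pair a' b') - 2 * ⟪pair 0 (b' - b), Q (pair a' b')⟫_ℝ
      + sqNorm Q (pair 0 (b' - b)) + energy B Q D₁ S D₂ T σ τ a' b' y'
      + sqNorm S (a' - a) + sqNorm T (b' - b)
      - 2 * σ * ⟪B.adjoint (b' - b), A.adjoint a' + B.adjoint b'⟫_ℝ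
      + σ * ‖B.adjoint (b' - b)‖ ^ 2 + (2 - τ) * σ * ‖A.adjoint a' + B.adjoint b'‖ ^ 2
      ≤ energy B Q D₁ S D₂ T σ τ a b y := by
  have hyn : (τ * σ)⁻¹ * ‖y'‖ ^ 2 = (τ * σ)⁻¹ * ‖y‖ ^ 2
      + 2 * ⟪y, A.adjoint a' + B.adjoint b'⟫_ℝ + τ * σ * ‖A.adjoint a' + B.adjoint b'‖ ^ 2 := by
    rw [hy, norm_add_smul_sq]
    field_simp
  simp only [energy, hyn]
  set α := A.adjoint a'
  simp only [map_sub]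
  set β := B.adjoint b
  set β' := B.adjoint b'
  have p1 : pair (a' - a) (b' - b) = pair a' 0 - pair a 0 + (pair 0 b' - pair 0 b) := by
    rw [← pair_sub, ← pair_sub, ← pair_add]; simp
  have p2 : pair (a' - a) (0 : V) = pair a' 0 - pair a 0 := by rw [← pair_sub]; simp
  have p3 : pair (0 : U) (b' - b) = pair 0 b' - pair 0 b := by rw [← pair_sub]; simp
  rw [p1] at h₂ h₃
  rw [p2] at h₁
  rw [p3]
  rw [pair_eq_add a b, pair_eq_add a' b'] at h₃
  rw [pair_eq_add a' b']
  have c1 := isPositive_inner_comm hQ (pair a' 0) (pair a (0 : V))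
  have c2 := isPositive_inner_comm hQ (pair a' 0) (pair (0 : U) b)
  have c3 := isPositive_inner_comm hQ (pair a' 0) (pair (0 : U) b')
  have c4 := isPositive_inner_comm hQ (pair a 0) (pair (0 : U) b)
  have c5 := isPositive_inner_comm hQ (pair a 0) (pair (0 : U) b')
  have c6 := isPositive_inner_comm hQ (pair (0 : U) b) (pair (0 : U) b')
  have c7 := isPositive_inner_comm hD₁ a a'
  have c8 := isPositive_inner_comm hS a a'
  have c9 := isPositive_inner_comm hD₂ b b'
  have c10 := isPositive_inner_comm hT b b'
  have d1 := real_inner_comm α β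
  have d2 := real_inner_comm α β'
  have d3 := real_inner_comm β β'
  rw [real_inner_comm] at h₁ h₂
  rw [real_inner_comm a' (S _)] at h₁
  rw [real_inner_comm b' (T _)] at h₂
  rw [real_inner_comm] at h₃
  simp only [sqNorm, ← real_inner_self_eq_norm_sq, map_sub, map_add, inner_add_left,
    inner_add_right, inner_sub_left, inner_sub_right, inner_smul_left, conj_trivial,
    add_apply, blockDiag_pair, inner_pair, inner_zero_left, inner_zero_right, map_zero,
    sub_zero, add_zero, zero_add, d1, d2, d3] at *
  -- The claim is twice the sum of `h₁`, `h₂`, `h₃` after polarization. The `D₁`, `D₂` parts of the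
  -- step, produced by polarization, cancel against the majorization error in `h₃`, so no `D`-terms
  -- survive in the decrease.
  linarith

/-- The relations satisfied by the errors `(uᵏ - ū, vᵏ - v̄, xᵏ - x̄)` of the majorized ADMM. -/
structure ErrorDynamics (A : X →L[ℝ] U) (B : X →L[ℝ] V)
    (Q : WithLp 2 (U × V) →L[ℝ] WithLp 2 (U × V))
    (D₁ S : U →L[ℝ] U) (D₂ T : V →L[ℝ] V) (σ τ η : ℝ)
    (a : ℕ → U) (b : ℕ → V) (y : ℕ → X) (r : ℕ → X) : Prop where
  resid : ∀ k, r k = A.adjoint (a k) + B.adjoint (b k)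
  step : ∀ k, y (k + 1) = y k + (τ * σ) • r (k + 1)
  descent : ∀ k, 2 * sqNorm Q (pair (a (k + 1)) (b (k + 1)))
      - 2 * ⟪pair 0 (b (k + 1) - b k), Q (pair (a (k + 1)) (b (k + 1)))⟫_ℝ
      + sqNorm Q (pair 0 (b (k + 1) - b k))
      + energy B Q D₁ S D₂ T σ τ (a (k + 1)) (b (k + 1)) (y (k + 1))
      + sqNorm S (a (k + 1) - a k) + sqNorm T (b (k + 1) - b k)
      - 2 * σ * ⟪B.adjoint (b (k + 1) - b k), r (k + 1)⟫_ℝ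
      + σ * ‖B.adjoint (b (k + 1) - b k)‖ ^ 2 + (2 - τ) * σ * ‖r (k + 1)‖ ^ 2
      ≤ energy B Q D₁ S D₂ T σ τ (a k) (b k) (y k)
  coupling : ∀ k, 2 * σ * ⟪B.adjoint (b (k + 2) - b (k + 1)), r (k + 2)⟫_ℝ
      - 2 * (1 - τ) * σ * ⟪B.adjoint (b (k + 2) - b (k + 1)), r (k + 1)⟫_ℝ
      + 2 * ⟪pair 0 (b (k + 2) - b (k + 1)),
          Q (pair (a (k + 2)) (b (k + 2)) - pair (a (k + 1)) (b (k + 1)))⟫_ℝ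
      ≤ η * (sqNorm D₁ (a (k + 1) - a k) + sqNorm D₂ (b (k + 2) - b (k + 1)))
        + (sqNorm D₂ (b (k + 1) - b k) + sqNorm T (b (k + 1) - b k))
        - (sqNorm D₂ (b (k + 2) - b (k + 1)) + sqNorm T (b (k + 2) - b (k + 1)))

theorem sum_range_le_of_descent {ψ d : ℕ → ℝ} (hψ : ∀ k, 0 ≤ ψ k)
    (h : ∀ k, ψ (k + 1) + d k ≤ ψ k) (n : ℕ) : ∑ i ∈ Finset.range n, d i ≤ ψ 0 := by
  have : ∑ i ∈ Finset.range n, d i ≤ ψ 0 - ψ n := by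
    induction n with
    | zero => simp
    | succ n ih => rw [Finset.sum_range_succ]; linarith [h n]
  linarith [hψ n]

/-- The Lyapunov terms after the first step are controlled by the initial error. -/
theorem ErrorDynamics.first_step (hQ : Q.IsPositive) (hS : S.IsPositive) (hT : T.IsPositive)
    (hσ : 0 < σ) (hτ : 0 < τ)
    {a : ℕ → U} {b : ℕ → V} {y r : ℕ → X} (h : ErrorDynamics A B Q D₁ S D₂ T σ τ η a b y r) :
    1 / 2 * sqNorm Q (pair (a 1) (b 1)) + sqNorm D₁ (a 1) + sqNorm S (a 1) + sqNorm D₂ (b 1)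
      + sqNorm T (b 1) + sqNorm Q (pair 0 (b 1)) + σ * ‖B.adjoint (b 1)‖ ^ 2 + σ / 2 * ‖r 1‖ ^ 2
      ≤ 1 / 2 * sqNorm Q (pair (a 0) (b 0)) + energy B Q D₁ S D₂ T σ τ (a 0) (b 0) (y 0)
        + 2 / σ * ‖y 0‖ ^ 2 := by
  have h1 := h.descent 0
  simp only [zero_add] at h1
  have h2 := coupled_quadratic_le hQ (pair (a 0) (b 0)) (pair (a 1) (b 1)) (pair 0 (b 1 - b 0))
  have h3 : 0 ≤ sqNorm Q (pair (a 1) (b 1) - pair (a 0) (b 0)) := sqNorm_nonneg hQ _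
  have h4 : 0 ≤ sqNorm S (a 1 - a 0) := sqNorm_nonneg hS _
  have h5 : 0 ≤ sqNorm T (b 1 - b 0) := sqNorm_nonneg hT _
  have hyn : (τ * σ)⁻¹ * ‖y 1‖ ^ 2 = (τ * σ)⁻¹ * ‖y 0‖ ^ 2
      + 2 * ⟪y 0, r 1⟫_ℝ + τ * σ * ‖r 1‖ ^ 2 := by
    rw [h.step 0, norm_add_smul_sq]
    field_simp
  -- Once `y 1` is expanded, `‖r 1‖²` has total weight `2σ` for every `τ`: one `σ` absorbs the
  -- product with `B*`, and half of the other absorbs `2⟪y 0, r 1⟫`, at the cost of `2/σ ‖y 0‖²`.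
  have h6 : 0 ≤ σ * ‖B.adjoint (b 1 - b 0) - r 1‖ ^ 2 := by positivity
  have h7 : 0 ≤ σ / 2 * ‖r 1 + (2 / σ) • y 0‖ ^ 2 := by positivity
  rw [norm_sub_sq_real] at h6
  rw [norm_add_smul_sq, real_inner_comm] at h7
  have h8 : σ / 2 * (‖r 1‖ ^ 2 + 2 / σ * (2 * ⟪y 0, r 1⟫_ℝ) + (2 / σ) ^ 2 * ‖y 0‖ ^ 2)
      = σ / 2 * ‖r 1‖ ^ 2 + 2 * ⟪y 0, r 1⟫_ℝ + 2 / σ * ‖y 0‖ ^ 2 := by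
    field_simp
  rw [h8] at h7
  have h9 : 0 ≤ (τ * σ)⁻¹ * ‖y 0‖ ^ 2 := by positivity
  simp only [energy, hyn] at h1 ⊢
  linarith

end Energy

/-! ### Square-summability of steps and residuals in the two regimes of `τ`. -/

section Summability

variable {U V X : Type*}
  [NormedAddCommGroup U] [InnerProductSpace ℝ U]
  [NormedAddCommGroup V] [InnerProductSpace ℝ V]
  [NormedAddCommGroup X] [InnerProductSpace ℝ X]
  [FiniteDimensional ℝ U] [FiniteDimensional ℝ V] [FiniteDimensional ℝ X]
  {A : X →L[ℝ] U} {B : X →L[ℝ] V} {Q : WithLp 2 (U × V) →L[ℝ] WithLp 2 (U × V)}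
  {D₁ S : U →L[ℝ] U} {D₂ T : V →L[ℝ] V} {σ τ η : ℝ}

theorem norm_add_sq_le_two {E : Type*} [NormedAddCommGroup E] [InnerProductSpace ℝ E] (a b : E) :
    ‖a + b‖ ^ 2 ≤ 2 * ‖a‖ ^ 2 + 2 * ‖b‖ ^ 2 := by
  have := sq_nonneg ‖a - b‖
  rw [norm_sub_sq_real] at this
  rw [norm_add_sq_real]
  linarith

theorem norm_sub_sq_le_two {E : Type*} [NormedAddCommGroup E] [InnerProductSpace ℝ E] (a b : E) :
    ‖a - b‖ ^ 2 ≤ 2 * ‖a‖ ^ 2 + 2 * ‖b‖ ^ 2 := by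
  simpa [sub_eq_add_neg] using norm_add_sq_le_two a (-b)

theorem sqNorm_sub_le_two {E : Type*} [NormedAddCommGroup E] [InnerProductSpace ℝ E]
    {G : E →L[ℝ] E} (hG : G.IsPositive) (a b : E) :
    sqNorm G (a - b) ≤ 2 * sqNorm G a + 2 * sqNorm G b := by
  have h : 0 ≤ sqNorm G (a + b) := sqNorm_nonneg hG _
  rw [sqNorm_add hG] at h
  rw [sqNorm_sub hG]
  linarith

/-- The Lyapunov functions below start at index 1, so their initial value must be controlled by the
error at index 0, uniformly over all sequences. The missing multiplier term `‖y 1‖²` is recovered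
from `y 0` and `r 1` through the dual update. -/
theorem exists_first_step_bound (hQ : Q.IsPositive) (hD₁ : D₁.IsPositive) (hD₂ : D₂.IsPositive)
    (hS : S.IsPositive) (hT : T.IsPositive) (hσ : 0 < σ) (hτ : 0 < τ) :
    ∃ M, 0 ≤ M ∧ ∀ (a : ℕ → U) (b : ℕ → V) (y r : ℕ → X),
      ErrorDynamics A B Q D₁ S D₂ T σ τ η a b y r →
      1 / 2 * sqNorm Q (pair (a 1) (b 1)) + energy B Q D₁ S D₂ T σ τ (a 1) (b 1) (y 1)
        + σ / 2 * ‖r 1‖ ^ 2 ≤ M * errSq (a 0) (b 0) (y 0) ∧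
      energy B Q D₁ S D₂ T σ τ (a 0) (b 0) (y 0) ≤ M * errSq (a 0) (b 0) (y 0) := by
  obtain ⟨M, hM, hMle⟩ := exists_initial_bound B Q D₁ S D₂ T hσ hτ
  refine ⟨M + 2 * (τ * σ)⁻¹ + 4 * τ * M, by positivity, fun a b y r h => ?_⟩
  have h1 := h.first_step hQ hS hT hσ hτ
  have h2 := hMle (a 0) (b 0) (y 0)
  have hE : 0 ≤ errSq (a 0) (b 0) (y 0) := by unfold errSq; positivity
  have hyE : ‖y 0‖ ^ 2 ≤ errSq (a 0) (b 0) (y 0) := by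
    have := sq_nonneg ‖a 0‖; have := sq_nonneg ‖b 0‖; unfold errSq; linarith
  have e1 : 0 ≤ sqNorm Q (pair (a 0) (b 0)) := sqNorm_nonneg hQ _
  have e2 : 0 ≤ 2 / σ * ‖y 0‖ ^ 2 := by positivity
  have e3 : 0 ≤ 2 * (τ * σ)⁻¹ * errSq (a 0) (b 0) (y 0) := by positivity
  have e4 : 0 ≤ 4 * τ * M * errSq (a 0) (b 0) (y 0) := by positivity
  refine ⟨?_, by linarith⟩
  have f0 : 0 ≤ sqNorm Q (pair (a 1) (b 1)) := sqNorm_nonneg hQ _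
  have f1 : 0 ≤ sqNorm D₁ (a 1) := sqNorm_nonneg hD₁ _
  have f2 : 0 ≤ sqNorm S (a 1) := sqNorm_nonneg hS _
  have f3 : 0 ≤ sqNorm D₂ (b 1) := sqNorm_nonneg hD₂ _
  have f4 : 0 ≤ sqNorm T (b 1) := sqNorm_nonneg hT _
  have f5 : 0 ≤ sqNorm Q (pair 0 (b 1)) := sqNorm_nonneg hQ _
  have f6 : 0 ≤ σ * ‖B.adjoint (b 1)‖ ^ 2 := by positivity
  have g1 : σ / 2 * ‖r 1‖ ^ 2 ≤ M * errSq (a 0) (b 0) (y 0) := by linarith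
  have g2 : (τ * σ)⁻¹ * ‖y 1‖ ^ 2 ≤ (τ * σ)⁻¹ * (2 * ‖y 0‖ ^ 2 + 2 * ‖(τ * σ) • r 1‖ ^ 2) := by
    have : ‖y 1‖ ^ 2 ≤ _ := h.step 0 ▸ norm_add_sq_le_two (y 0) ((τ * σ) • r 1)
    gcongr
  have g3 : (τ * σ)⁻¹ * (2 * ‖y 0‖ ^ 2 + 2 * ‖(τ * σ) • r 1‖ ^ 2)
      = 2 * (τ * σ)⁻¹ * ‖y 0‖ ^ 2 + 4 * τ * (σ / 2 * ‖r 1‖ ^ 2) := by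
    rw [norm_smul, mul_pow, Real.norm_eq_abs, sq_abs]
    field_simp
    ring
  have g4 : 4 * τ * (σ / 2 * ‖r 1‖ ^ 2) ≤ 4 * τ * (M * errSq (a 0) (b 0) (y 0)) := by gcongr
  have g5 : 2 * (τ * σ)⁻¹ * ‖y 0‖ ^ 2 ≤ 2 * (τ * σ)⁻¹ * errSq (a 0) (b 0) (y 0) := by gcongr
  simp only [energy]
  linarith

theorem inner_comp_adjoint (A : X →L[ℝ] U) (a : U) :
    ⟪a, A (A.adjoint a)⟫_ℝ = ‖A.adjoint a‖ ^ 2 := by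
  rw [← real_inner_self_eq_norm_sq, ContinuousLinearMap.adjoint_inner_left]

/-- Square-summability of steps and residuals for step lengths `τ ≤ 1`. -/
theorem exists_sum_bound_of_le_one (hQ : Q.IsPositive) (hD₁ : D₁.IsPositive)
    (hD₂ : D₂.IsPositive) (hS : S.IsPositive) (hT : T.IsPositive) (hσ : 0 < σ) (hτ : 0 < τ)
    (hτ₁ : τ ≤ 1)
    (hO : PosDef ((1 / 4 : ℝ) • Q
          + blockDiag (S + ((1 - τ) * σ) • (A ∘L A.adjoint))
              (T + ((1 - τ) * σ) • (B ∘L B.adjoint)))) :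
    ∃ M, 0 ≤ M ∧ ∀ (a : ℕ → U) (b : ℕ → V) (y r : ℕ → X),
      ErrorDynamics A B Q D₁ S D₂ T σ τ η a b y r → ∀ n,
      ∑ i ∈ Finset.range n, (‖a (i + 2) - a (i + 1)‖ ^ 2 + ‖b (i + 2) - b (i + 1)‖ ^ 2
        + ‖r (i + 2)‖ ^ 2) ≤ M * errSq (a 0) (b 0) (y 0) := by
  obtain ⟨m, hm, hmO⟩ := hO.exists_coercive
  obtain ⟨M, hM, hMle⟩ := exists_first_step_bound (A := A) (B := B) (η := η) hQ hD₁ hD₂ hS hT hσ hτ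
  set N := ‖B.adjoint‖ ^ 2 with hN
  set K := (1 + 2 * N) * (4 / m) + 2 / σ with hK
  have hKpos : 0 < K := by positivity
  -- The square completed from the `B*` product leaves `(1 - τ)σ‖r‖²`. Half of it is stored in the
  -- Lyapunov function, so that the decrease contains both the new and the old residual; `hα` needs
  -- both to control `A* Δa`.
  set κ := (1 - τ) * σ / 2 with hκ
  have hκ0 : 0 ≤ κ := by
    have : 0 ≤ 1 - τ := by linarith
    positivity
  have hκσ : 2 * κ ≤ σ := by rw [hκ]; nlinarith
  refine ⟨K * (2 * M), by positivity, fun a b y r h n => ?_⟩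
  have hdesc := sum_range_le_of_descent
    (ψ := fun k => 1 / 2 * sqNorm Q (pair (a (k + 1)) (b (k + 1)))
      + energy B Q D₁ S D₂ T σ τ (a (k + 1)) (b (k + 1)) (y (k + 1)) + κ * ‖r (k + 1)‖ ^ 2)
    (d := fun i => K⁻¹ * (‖a (i + 2) - a (i + 1)‖ ^ 2 + ‖b (i + 2) - b (i + 1)‖ ^ 2
        + ‖r (i + 2)‖ ^ 2))
    (fun k => by
      have f1 : 0 ≤ sqNorm Q (pair (a (k + 1)) (b (k + 1))) := sqNorm_nonneg hQ _
      have f2 := energy_nonneg (B := B) hQ hD₁ hD₂ hS hT hσ hτ (a (k + 1)) (b (k + 1)) (y (k + 1))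
      positivity)
    (fun k => by
      have h1 := h.descent (k + 1)
      simp only [add_assoc, one_add_one_eq_two] at h1 ⊢
      have h2 := coupled_quadratic_le hQ (pair (a (k + 1)) (b (k + 1)))
        (pair (a (k + 2)) (b (k + 2))) (pair 0 (b (k + 2) - b (k + 1)))
      rw [← pair_sub] at h2
      have hα : A.adjoint (a (k + 2) - a (k + 1))
          = -(r (k + 1)) - (B.adjoint (b (k + 2) - b (k + 1)) - r (k + 2)) := by
        rw [h.resid, h.resid, map_sub, map_sub]; abel
      set Δa := a (k + 2) - a (k + 1)
      set Δb := b (k + 2) - b (k + 1)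
      have h3 := hmO (pair Δa Δb)
      simp only [add_apply, smul_apply, blockDiag_pair, inner_add_right, inner_smul_right,
        inner_pair, ContinuousLinearMap.comp_apply, inner_comp_adjoint, norm_pair_sq] at h3
      rw [hα] at h3
      set β := B.adjoint Δb with hβ
      have h4 := norm_sub_sq_le_two (-(r (k + 1))) (β - r (k + 2))
      have h5 := norm_add_sq_le_two (r (k + 2)) (β - r (k + 2))
      rw [norm_neg] at h4
      rw [add_sub_cancel] at h5
      -- At `τ = 1` the weight `κ` vanishes, so the residual is bounded through `B* Δb` and `s`
      -- instead.
      have h6 := norm_sub_sq_le_two β (β - r (k + 2))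
      rw [sub_sub_cancel] at h6
      have h7 : ‖β‖ ^ 2 ≤ N * ‖Δb‖ ^ 2 := by
        rw [hN, ← mul_pow]
        gcongr
        exact B.adjoint.le_opNorm Δb
      have h8 : σ * ‖β - r (k + 2)‖ ^ 2
          = σ * (‖β‖ ^ 2 - 2 * ⟪β, r (k + 2)⟫_ℝ + ‖r (k + 2)‖ ^ 2) := by rw [norm_sub_sq_real]
      have eQ : 0 ≤ sqNorm Q (pair Δa Δb) := sqNorm_nonneg hQ _
      have eS : 0 ≤ sqNorm S Δa := sqNorm_nonneg hS _
      have eT : 0 ≤ sqNorm T Δb := sqNorm_nonneg hT _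
      set s := ‖β - r (k + 2)‖ ^ 2
      have es : 0 ≤ s := by positivity
      set D := 1 / 4 * sqNorm Q (pair Δa Δb) + sqNorm S Δa + sqNorm T Δb
        + κ * ‖r (k + 2)‖ ^ 2 + κ * ‖r (k + 1)‖ ^ 2 + σ * s with hD
      have hr1 : 0 ≤ κ * ‖r (k + 1)‖ ^ 2 := by positivity
      have hr2 : 0 ≤ κ * ‖r (k + 2)‖ ^ 2 := by positivity
      have hsD : σ * s ≤ D := by linarith
      have k1 : m * (‖Δa‖ ^ 2 + ‖Δb‖ ^ 2) ≤ 4 * D := by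
        have j1 : (1 - τ) * σ * ‖-(r (k + 1)) - (β - r (k + 2))‖ ^ 2
            ≤ 2 * κ * (2 * ‖r (k + 1)‖ ^ 2 + 2 * s) := by
          rw [show (1 - τ) * σ = 2 * κ by rw [hκ]; ring]; gcongr
        have j2 : (1 - τ) * σ * ‖β‖ ^ 2 ≤ 2 * κ * (2 * ‖r (k + 2)‖ ^ 2 + 2 * s) := by
          rw [show (1 - τ) * σ = 2 * κ by rw [hκ]; ring]; gcongr
        have j3 : 2 * κ * s ≤ σ * s := by gcongr
        simp only [sqNorm] at *
        linarith
      have k2 : ‖Δa‖ ^ 2 + ‖Δb‖ ^ 2 ≤ 4 / m * D := by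
        rw [div_mul_eq_mul_div, le_div_iff₀ hm]; linarith
      have k3 : s ≤ σ⁻¹ * D := by
        rw [inv_mul_eq_div, le_div_iff₀ hσ]; linarith
      have k4 : ‖Δa‖ ^ 2 + ‖Δb‖ ^ 2 + ‖r (k + 2)‖ ^ 2 ≤ K * D := by
        have j1 : N * ‖Δb‖ ^ 2 ≤ N * (4 / m * D) := by
          have := sq_nonneg ‖Δa‖
          gcongr; linarith
        have j2 : K * D = 4 / m * D + 2 * (N * (4 / m * D)) + 2 * (σ⁻¹ * D) := by
          rw [hK]; ring
        rw [j2]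
        linarith
      have k5 : K⁻¹ * (‖Δa‖ ^ 2 + ‖Δb‖ ^ 2 + ‖r (k + 2)‖ ^ 2) ≤ D := by
        rw [inv_mul_eq_div, div_le_iff₀ hKpos]; linarith
      have k6 : 2 * (κ * ‖r (k + 2)‖ ^ 2) = (1 - τ) * σ * ‖r (k + 2)‖ ^ 2 := by rw [hκ]; ring
      linarith) n
  have h0 := (hMle a b y r h).1
  have h1 : κ * ‖r 1‖ ^ 2 ≤ σ / 2 * ‖r 1‖ ^ 2 := by gcongr; linarith
  have hE : 0 ≤ M * errSq (a 0) (b 0) (y 0) := by unfold errSq; positivity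
  rw [← Finset.mul_sum, inv_mul_le_iff₀ hKpos] at hdesc
  refine hdesc.trans ?_
  rw [mul_assoc]
  gcongr
  simp only [zero_add]
  linarith

/-- Square-summability of steps and residuals for step lengths below the golden ratio. -/
theorem exists_sum_bound_of_lt_golden (hQ : Q.IsPositive) (hD₁ : D₁.IsPositive)
    (hD₂ : D₂.IsPositive) (hS : S.IsPositive) (hT : T.IsPositive) (hσ : 0 < σ) (hτ : 0 < τ)
    (hη : 0 ≤ η) (hτ₁ : τ < (1 + Real.sqrt 5) / 2)
    (hP : ((1 / 4 : ℝ) • Q + blockDiag (S - η • D₁) (T - η • D₂)).IsPositive)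
    (hO : PosDef ((1 / 4 : ℝ) • Q
          + blockDiag (S + σ • (A ∘L A.adjoint) - η • D₁)
              (T + σ • (B ∘L B.adjoint) - η • D₂))) :
    ∃ M, 0 ≤ M ∧ ∀ (a : ℕ → U) (b : ℕ → V) (y r : ℕ → X),
      ErrorDynamics A B Q D₁ S D₂ T σ τ η a b y r → ∀ n,
      ∑ i ∈ Finset.range n, (‖a (i + 2) - a (i + 1)‖ ^ 2 + ‖b (i + 2) - b (i + 1)‖ ^ 2
        + ‖r (i + 2)‖ ^ 2) ≤ M * errSq (a 0) (b 0) (y 0) := by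
  obtain ⟨m, hm, hmO⟩ := hO.exists_coercive
  obtain ⟨M, hM, hMle⟩ := exists_first_step_bound (A := A) (B := B) (η := η) hQ hD₁ hD₂ hS hT hσ hτ
  have hgold : τ ^ 2 < 1 + τ := by
    have h5 : Real.sqrt 5 ^ 2 = 5 := Real.sq_sqrt (by norm_num)
    have h51 : 1 < Real.sqrt 5 := Real.lt_sqrt_of_sq_lt (by norm_num)
    have := sq_lt_sq' (show -Real.sqrt 5 < 2 * τ - 1 by linarith) (by linarith)
    linarith
  -- `δ` is positive exactly below the golden ratio. With the factor `1/4`, `(1 - δ)(κ - δ) = (1 -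
  -- τ)² + τδ + 2δ²`, so the form in `h5` is nonnegative after `δ` has been removed from each of its
  -- square coefficients.
  set δ := (1 + τ - τ ^ 2) / 4 with hδ
  have hδ0 : 0 < δ := by linarith
  have hδ1 : δ < 1 := by nlinarith [sq_nonneg (τ - 1 / 2)]
  set κ := 2 - τ - δ with hκ
  have hκδ : (1 - τ) ^ 2 ≤ (1 - δ) * (κ - δ) := by nlinarith [mul_pos hτ hδ0, sq_nonneg δ]
  have hκ0 : 0 ≤ κ := by nlinarith
  set K := (1 + 4 / δ) / m + (δ * σ)⁻¹ with hK
  have hKpos : 0 < K := by positivity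
  -- With `Z` the first-step bound, the initial Lyapunov value is at most `3Z` (energy and `3/2` of
  -- the `Q`-term) plus `4Z` (the `D₂` and `T` steps) plus `4ηZ` plus `2κZ`.
  refine ⟨K * ((7 + 4 * η + 2 * κ) * M), by positivity, fun a b y r h n => ?_⟩
  have hdesc := sum_range_le_of_descent
    (ψ := fun k => 3 / 2 * sqNorm Q (pair (a (k + 1)) (b (k + 1)))
      + energy B Q D₁ S D₂ T σ τ (a (k + 1)) (b (k + 1)) (y (k + 1))
      + (sqNorm D₂ (b (k + 1) - b k) + sqNorm T (b (k + 1) - b k))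
      + η * sqNorm D₁ (a (k + 1) - a k) + κ * σ * ‖r (k + 1)‖ ^ 2)
    (d := fun i => K⁻¹ * (‖a (i + 2) - a (i + 1)‖ ^ 2 + ‖b (i + 2) - b (i + 1)‖ ^ 2
        + ‖r (i + 2)‖ ^ 2))
    (fun k => by
      have f1 : 0 ≤ sqNorm Q (pair (a (k + 1)) (b (k + 1))) := sqNorm_nonneg hQ _
      have f2 := energy_nonneg (B := B) hQ hD₁ hD₂ hS hT hσ hτ (a (k + 1)) (b (k + 1)) (y (k + 1))
      have f3 : 0 ≤ sqNorm D₂ (b (k + 1) - b k) := sqNorm_nonneg hD₂ _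
      have f4 : 0 ≤ sqNorm T (b (k + 1) - b k) := sqNorm_nonneg hT _
      have f5 : 0 ≤ sqNorm D₁ (a (k + 1) - a k) := sqNorm_nonneg hD₁ _
      positivity)
    (fun k => by
      have h1 := h.descent (k + 1)
      -- Added to the descent, this replaces the product of `β` with `r (k + 2)` by `1 - τ` times
      -- the one with `r (k + 1)`. Its `η`-terms must be paid from the decrease, hence `S - η D₁`
      -- and `T - η D₂`.
      have hc := h.coupling k
      simp only [add_assoc, one_add_one_eq_two] at h1 ⊢
      have h2 := coupled_quadratic_le' hQ (pair (a (k + 1)) (b (k + 1)))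
        (pair (a (k + 2)) (b (k + 2))) (pair 0 (b (k + 2) - b (k + 1)))
      rw [← pair_sub (a (k + 2))] at h2 hc
      have hα : A.adjoint (a (k + 2) - a (k + 1))
          = r (k + 2) - (r (k + 1) + B.adjoint (b (k + 2) - b (k + 1))) := by
        rw [h.resid, h.resid, map_sub, map_sub]; abel
      set Δa := a (k + 2) - a (k + 1)
      set Δb := b (k + 2) - b (k + 1)
      have h3 := hmO (pair Δa Δb)
      have hPos := sqNorm_nonneg hP (pair Δa Δb)
      simp only [add_apply, sub_apply, smul_apply, blockDiag_pair, inner_add_right,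
        inner_sub_right, inner_smul_right, inner_pair, ContinuousLinearMap.comp_apply,
        inner_comp_adjoint, norm_pair_sq] at h3 hPos
      rw [hα] at h3
      set β := B.adjoint Δb with hβ
      -- The factor 3 would suffice; with 4, one `‖β‖²` is left over to pay for the `B B*` block of
      -- `O₂`.
      have h4 : ‖r (k + 2) - (r (k + 1) + β)‖ ^ 2
          ≤ 4 * (‖r (k + 2)‖ ^ 2 + ‖r (k + 1)‖ ^ 2 + ‖β‖ ^ 2) - ‖β‖ ^ 2 := by
        have j1 := sq_nonneg ‖r (k + 2) + (r (k + 1))‖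
        have j2 := sq_nonneg ‖r (k + 2) + β‖
        have j3 := sq_nonneg ‖r (k + 1) - β‖
        have j4 := sq_nonneg ‖r (k + 2)‖
        have j5 := sq_nonneg ‖r (k + 1)‖
        rw [norm_add_sq_real] at j1 j2
        rw [norm_sub_sq_real] at j3 ⊢
        rw [norm_add_sq_real, inner_add_right]
        linarith
      have h5 : 0 ≤ (1 - δ) * ‖β‖ ^ 2 + (κ - δ) * ‖r (k + 1)‖ ^ 2
          - 2 * (1 - τ) * ⟪β, r (k + 1)⟫_ℝ := by
        have j1 := sq_nonneg ‖(1 - δ) • β + (-(1 - τ)) • r (k + 1)‖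
        rw [norm_add_smul_sq, norm_smul, mul_pow, Real.norm_eq_abs, sq_abs,
          inner_smul_left, conj_trivial] at j1
        have j2 : (1 - τ) ^ 2 * ‖r (k + 1)‖ ^ 2 ≤ (1 - δ) * (κ - δ) * ‖r (k + 1)‖ ^ 2 := by gcongr
        have j3 : 0 ≤ (1 - δ) * ((1 - δ) * ‖β‖ ^ 2 + (κ - δ) * ‖r (k + 1)‖ ^ 2
          - 2 * (1 - τ) * ⟪β, r (k + 1)⟫_ℝ) := by linarith
        exact nonneg_of_mul_nonneg_right j3 (by linarith)
      have h6 := mul_nonneg hσ.le h5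
      set R := ‖r (k + 2)‖ ^ 2 + ‖r (k + 1)‖ ^ 2 + ‖β‖ ^ 2 with hR
      set P := 1 / 4 * sqNorm Q (pair Δa Δb) + (sqNorm S Δa - η * sqNorm D₁ Δa)
        + (sqNorm T Δb - η * sqNorm D₂ Δb) with hPdef
      have hP0 : 0 ≤ P := by
        simp only [hPdef, sqNorm]; linarith
      have hR0 : 0 ≤ R := by positivity
      have hRσ : 0 ≤ δ * σ * R := by positivity
      have k1 : m * (‖Δa‖ ^ 2 + ‖Δb‖ ^ 2) ≤ (1 + 4 / δ) * (P + δ * σ * R) := by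
        have j1 : σ * ‖r (k + 2) - (r (k + 1) + β)‖ ^ 2 ≤ σ * (4 * R - ‖β‖ ^ 2) := by gcongr
        have j2 : (1 + 4 / δ) * (P + δ * σ * R)
            = P + 4 * σ * R + δ * σ * R + 4 / δ * P := by field_simp; ring
        have j3 : 0 ≤ 4 / δ * P := by positivity
        rw [j2]
        simp only [hPdef, sqNorm] at *
        linarith
      have k2 : ‖Δa‖ ^ 2 + ‖Δb‖ ^ 2 ≤ (1 + 4 / δ) / m * (P + δ * σ * R) := by
        rw [div_mul_eq_mul_div, le_div_iff₀ hm]; linarith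
      have k3 : ‖r (k + 2)‖ ^ 2 ≤ (δ * σ)⁻¹ * (P + δ * σ * R) := by
        rw [inv_mul_eq_div, le_div_iff₀ (by positivity)]
        have : ‖r (k + 2)‖ ^ 2 ≤ R := by
          have := sq_nonneg ‖r (k + 1)‖; have := sq_nonneg ‖β‖; linarith
        have : ‖r (k + 2)‖ ^ 2 * (δ * σ) ≤ R * (δ * σ) := by gcongr
        linarith
      have k5 : K⁻¹ * (‖Δa‖ ^ 2 + ‖Δb‖ ^ 2 + ‖r (k + 2)‖ ^ 2) ≤ P + δ * σ * R := by
        rw [inv_mul_eq_div, div_le_iff₀ hKpos, hK]; linarith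
      have k6 : κ * σ * ‖r (k + 2)‖ ^ 2 = (2 - τ) * σ * ‖r (k + 2)‖ ^ 2
        - δ * σ * ‖r (k + 2)‖ ^ 2 := by rw [hκ]; ring
      rw [hPdef, hR] at k5
      clear_value δ κ K
      linarith) n
  obtain ⟨h0, h0'⟩ := hMle a b y r h
  have hQ1 : 0 ≤ sqNorm Q (pair (a 1) (b 1)) := sqNorm_nonneg hQ _
  have hr1 : 0 ≤ σ / 2 * ‖r 1‖ ^ 2 := by positivity
  obtain ⟨e1, e1'⟩ := le_energy (B := B) hQ hD₁ hD₂ hS hT hσ hτ (a 1) (b 1) (y 1)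
  obtain ⟨e0, e0'⟩ := le_energy (B := B) hQ hD₁ hD₂ hS hT hσ hτ (a 0) (b 0) (y 0)
  have en := energy_nonneg (B := B) hQ hD₁ hD₂ hS hT hσ hτ (a 1) (b 1) (y 1)
  have hE : 0 ≤ M * errSq (a 0) (b 0) (y 0) := by unfold errSq; positivity
  have g1 := sqNorm_sub_le_two hD₁ (a 1) (a 0)
  have g2 := sqNorm_sub_le_two hD₂ (b 1) (b 0)
  have g3 := sqNorm_sub_le_two hT (b 1) (b 0)
  set Z := M * errSq (a 0) (b 0) (y 0)
  have g4 : η * sqNorm D₁ (a 1 - a 0) ≤ η * (4 * Z) := by gcongr; linarith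
  have g5 : κ * (σ * ‖r 1‖ ^ 2) ≤ κ * (2 * Z) := mul_le_mul_of_nonneg_left (by linarith) hκ0
  rw [← Finset.mul_sum, inv_mul_le_iff₀ hKpos] at hdesc
  refine hdesc.trans ?_
  rw [mul_assoc, mul_assoc]
  gcongr
  simp only [zero_add]
  linarith

end Summability

/-! ### Existence of a Lagrange multiplier. -/

section Multiplier

/-- Segments ending at a relative interior point can be prolonged, since the line through them stays
in the affine span. -/
theorem exists_add_smul_sub_mem_of_mem_intrinsicInterior {E : Type*} [NormedAddCommGroup E]
    [NormedSpace ℝ E] {s : Set E} {z w : E} (hz : z ∈ intrinsicInterior ℝ s) (hw : w ∈ s) :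
    ∃ ε : ℝ, 0 < ε ∧ z + ε • (z - w) ∈ s := by
  obtain ⟨y, hy, rfl⟩ := mem_intrinsicInterior.1 hz
  have hmem : ∀ t : ℝ, (y : E) + t • ((y : E) - w) ∈ affineSpan ℝ s := by
    intro t
    have := AffineMap.lineMap_mem (-t) y.2 (subset_affineSpan ℝ s hw)
    rw [AffineMap.lineMap_apply, vsub_eq_sub, vadd_eq_add] at this
    convert this using 1
    module
  let f : ℝ → affineSpan ℝ s := fun t => ⟨(y : E) + t • ((y : E) - w), hmem t⟩
  have hf : Continuous f := Continuous.subtype_mk (by fun_prop) _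
  have hf0 : f 0 = y := Subtype.ext (by simp [f])
  have hev : ∀ᶠ t in 𝓝 (0 : ℝ), f t ∈ interior ((↑) ⁻¹' s : Set (affineSpan ℝ s)) :=
    hf.continuousAt.eventually_mem (by rw [hf0]; exact isOpen_interior.mem_nhds hy)
  obtain ⟨ε, hε, hball⟩ := Metric.eventually_nhds_iff_ball.1 hev
  refine ⟨ε / 2, by positivity, ?_⟩
  have h1 := hball (ε / 2) (by simp [abs_of_pos hε, hε])
  have h2 : f (ε / 2) ∈ ((↑) ⁻¹' s : Set (affineSpan ℝ s)) := interior_subset h1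
  exact h2

variable {U V X : Type*}
  [NormedAddCommGroup U] [InnerProductSpace ℝ U] [FiniteDimensional ℝ U]
  [NormedAddCommGroup V] [InnerProductSpace ℝ V] [FiniteDimensional ℝ V]
  [NormedAddCommGroup X] [InnerProductSpace ℝ X] [FiniteDimensional ℝ X]
  {p : U → EReal} {q : V → EReal} {φ : WithLp 2 (U × V) → ℝ}
  {A : X →L[ℝ] U} {B : X →L[ℝ] V} {c : X}

theorem ClosedProperConvex.toReal_le_combo {E : Type*} [NormedAddCommGroup E]
    [InnerProductSpace ℝ E] {p : E → EReal} (hp : ClosedProperConvex p) {z y : E}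
    (hz : p z < ⊤) (hy : p y < ⊤) {t : ℝ} (h0 : 0 ≤ t) (h1 : t ≤ 1) :
    p (z + t • (y - z)) < ⊤ ∧
      (p (z + t • (y - z))).toReal ≤ (1 - t) * (p z).toReal + t * (p y).toReal := by
  have h := hp.le_combo hz hy h0 h1
  have hlt := h.trans_lt (EReal.coe_lt_top _)
  refine ⟨hlt, ?_⟩
  rw [← hp.coe_toReal hlt] at h
  exact_mod_cast h

theorem constr_combo (u₁ u₂ : U) (v₁ v₂ : V) (t : ℝ) :
    constr A B c (u₁ + t • (u₂ - u₁)) (v₁ + t • (v₂ - v₁))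
      = constr A B c u₁ v₁ + t • (constr A B c u₂ v₂ - constr A B c u₁ v₁) := by
  simp only [constr, map_add, map_smul, map_sub]
  module

/-- A separable convex function minimized over an affine subspace meeting the relative interior of
its domain admits a Lagrange multiplier. -/
theorem exists_multiplier (hp : ClosedProperConvex p) (hq : ClosedProperConvex q)
    (hCQ : ConstraintQualification p q A B c) (ℓ : WithLp 2 (U × V) →L[ℝ] ℝ) (m : ℝ)
    (hmin : ∀ u v, p u < ⊤ → q v < ⊤ → constr A B c u v = 0 →
      m ≤ (p u).toReal + (q v).toReal + ℓ (pair u v))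
    (hatt : ∃ u v, p u < ⊤ ∧ q v < ⊤ ∧ constr A B c u v = 0 ∧
      (p u).toReal + (q v).toReal + ℓ (pair u v) ≤ m) :
    ∃ x : X, ∀ u v, p u < ⊤ → q v < ⊤ →
      m ≤ (p u).toReal + (q v).toReal + ℓ (pair u v) + ⟪x, constr A B c u v⟫_ℝ := by
  obtain ⟨⟨u₀, v₀⟩, hz, hz0⟩ := hCQ
  obtain ⟨hu₀, hv₀⟩ := intrinsicInterior_subset hz
  simp only at hz0 hu₀ hv₀
  let ψ : U → V → ℝ := fun u v => (p u).toReal + (q v).toReal + ℓ (pair u v) - m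
  have hcombo : ∀ {u₁ u₂ v₁ v₂} {l₁ l₂ : ℝ}, 0 < l₁ → 0 < l₂ → p u₁ < ⊤ → q v₁ < ⊤ → p u₂ < ⊤ →
      q v₂ < ⊤ → ∃ u v, p u < ⊤ ∧ q v < ⊤ ∧
        (l₁ + l₂) • constr A B c u v = l₁ • constr A B c u₁ v₁ + l₂ • constr A B c u₂ v₂ ∧
        (l₁ + l₂) * ψ u v ≤ l₁ * ψ u₁ v₁ + l₂ * ψ u₂ v₂ := by
    intro u₁ u₂ v₁ v₂ l₁ l₂ hl₁ hl₂ hu₁ hv₁ hu₂ hv₂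
    have hl : 0 < l₁ + l₂ := by positivity
    have ht0 : 0 ≤ l₂ / (l₁ + l₂) := by positivity
    have ht1 : l₂ / (l₁ + l₂) ≤ 1 := by rw [div_le_one hl]; linarith
    have htl : (l₁ + l₂) * (l₂ / (l₁ + l₂)) = l₂ := by field_simp
    set t := l₂ / (l₁ + l₂)
    obtain ⟨hu, hu'⟩ := hp.toReal_le_combo hu₁ hu₂ ht0 ht1
    obtain ⟨hv, hv'⟩ := hq.toReal_le_combo hv₁ hv₂ ht0 ht1
    refine ⟨_, _, hu, hv, ?_, ?_⟩
    · rw [constr_combo, smul_add, smul_smul, htl]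
      module
    · have hℓ : ℓ (pair (u₁ + t • (u₂ - u₁)) (v₁ + t • (v₂ - v₁)))
          = (1 - t) * ℓ (pair u₁ v₁) + t * ℓ (pair u₂ v₂) := by
        rw [pair_add, pair_smul, pair_sub, map_add, map_smul, map_sub, smul_eq_mul]
        ring
      have h1 : ψ (u₁ + t • (u₂ - u₁)) (v₁ + t • (v₂ - v₁))
          ≤ (1 - t) * ψ u₁ v₁ + t * ψ u₂ v₂ := by
        simp only [ψ, hℓ]
        linarith
      calc _ ≤ (l₁ + l₂) * ((1 - t) * ψ u₁ v₁ + t * ψ u₂ v₂) := by gcongr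
        _ = (l₁ + l₂ - (l₁ + l₂) * t) * ψ u₁ v₁ + (l₁ + l₂) * t * ψ u₂ v₂ := by ring
        _ = _ := by rw [htl]; ring
  let L : Submodule ℝ X := Submodule.span ℝ {y | ∃ u v, p u < ⊤ ∧ q v < ⊤ ∧ constr A B c u v = y}
  -- The cone generated by the attainable residuals is already a subspace. Negative multiples come
  -- from prolonging the segment from `(u, v)` past the feasible relative interior point, where the
  -- residual is zero.
  have hL : ∀ y ∈ L, ∃ l : ℝ, 0 < l ∧ ∃ u v, p u < ⊤ ∧ q v < ⊤ ∧ y = l • constr A B c u v := by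
    intro y hy
    induction hy using Submodule.span_induction with
    | mem y hy =>
      obtain ⟨u, v, hu, hv, rfl⟩ := hy
      exact ⟨1, one_pos, u, v, hu, hv, (one_smul _ _).symm⟩
    | zero => exact ⟨1, one_pos, u₀, v₀, hu₀, hv₀, by rw [hz0, smul_zero]⟩
    | add y₁ y₂ _ _ h₁ h₂ =>
      obtain ⟨l₁, hl₁, u₁, v₁, hu₁, hv₁, rfl⟩ := h₁
      obtain ⟨l₂, hl₂, u₂, v₂, hu₂, hv₂, rfl⟩ := h₂
      obtain ⟨u, v, hu, hv, h, -⟩ := hcombo hl₁ hl₂ hu₁ hv₁ hu₂ hv₂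
      exact ⟨_, add_pos hl₁ hl₂, u, v, hu, hv, h.symm⟩
    | smul a y _ h =>
      obtain ⟨l, hl, u, v, hu, hv, rfl⟩ := h
      rcases lt_trichotomy a 0 with ha | rfl | ha
      · obtain ⟨ε, hε, hmem⟩ := exists_add_smul_sub_mem_of_mem_intrinsicInterior hz
          (show (u, v) ∈ dom p ×ˢ dom q from ⟨hu, hv⟩)
        refine ⟨-a * l / ε, by have := neg_pos.2 ha; positivity, _, _, hmem.1, hmem.2, ?_⟩
        have h1 := constr_combo (A := A) (B := B) (c := c) u₀ u v₀ v (-ε)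
        rw [hz0, sub_zero, zero_add] at h1
        have h2 : constr A B c ((u₀, v₀) + ε • ((u₀, v₀) - (u, v))).1
            ((u₀, v₀) + ε • ((u₀, v₀) - (u, v))).2 = (-ε) • constr A B c u v := by
          rw [← h1]
          simp only [Prod.fst_add, Prod.snd_add, Prod.smul_fst, Prod.smul_snd, Prod.fst_sub,
            Prod.snd_sub]
          congr 1 <;> module
        rw [h2, smul_smul, smul_smul]
        congr 1
        field_simp
      · exact ⟨1, one_pos, u₀, v₀, hu₀, hv₀, by rw [hz0, smul_zero, zero_smul]⟩
      · exact ⟨a * l, by positivity, u, v, hu, hv, smul_smul _ _ _⟩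
  let s : ConvexCone ℝ (X × ℝ) :=
    { carrier := {z | ∃ l : ℝ, 0 < l ∧ ∃ u v, p u < ⊤ ∧ q v < ⊤ ∧
        z.1 = l • constr A B c u v ∧ l * ψ u v ≤ z.2}
      smul_mem' := by
        rintro a ha z ⟨l, hl, u, v, hu, hv, h1, h2⟩
        refine ⟨a * l, by positivity, u, v, hu, hv, ?_, ?_⟩
        · rw [Prod.smul_fst, h1, smul_smul]
        · rw [Prod.smul_snd, smul_eq_mul, mul_assoc]
          gcongr
      add_mem' := by
        rintro z₁ ⟨l₁, hl₁, u₁, v₁, hu₁, hv₁, h₁, h₁'⟩ z₂ ⟨l₂, hl₂, u₂, v₂, hu₂, hv₂, h₂, h₂'⟩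
        obtain ⟨u, v, hu, hv, h, h'⟩ := hcombo hl₁ hl₂ hu₁ hv₁ hu₂ hv₂
        refine ⟨_, add_pos hl₁ hl₂, u, v, hu, hv, ?_, ?_⟩
        · rw [h, Prod.fst_add, h₁, h₂]
        · rw [Prod.snd_add]; linarith }
  -- The functional `(y, t) ↦ t` is to be extended nonnegatively on the cone `s`. Its domain
  -- includes `Lᗮ` so that, by `hL`, every vector can be moved into `s` by adding an element of the
  -- domain. On the domain itself, membership in `s` forces a zero residual, so nonnegativity is the
  -- optimality `hmin`.
  let f : (X × ℝ) →ₗ.[ℝ] ℝ := ⟨Lᗮ.prod ⊤, (LinearMap.snd ℝ X ℝ).comp (Submodule.subtype _)⟩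
  have hs0 : s.Pointed := by
    obtain ⟨u, v, hu, hv, h0, hle⟩ := hatt
    refine ⟨1, one_pos, u, v, hu, hv, by simp [h0], ?_⟩
    simp only [ψ, Prod.snd_zero]
    linarith
  obtain ⟨g, hgf, hgs⟩ := riesz_extension (s.toPointedCone hs0) f (by
      rintro ⟨⟨y, t⟩, hyt⟩ ⟨l, hl, u, v, hu, hv, h1, h2⟩
      have hy : y ∈ Lᗮ := hyt.1
      have hyL : y ∈ L := by
        rw [show y = l • constr A B c u v from h1]
        exact L.smul_mem _ (Submodule.subset_span ⟨u, v, hu, hv, rfl⟩)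
      have hy0 : y = 0 := by
        simpa using Submodule.inner_right_of_mem_orthogonal hyL hy
      have h0 : constr A B c u v = 0 := by
        have h3 : l • constr A B c u v = 0 := h1.symm.trans hy0
        exact (smul_eq_zero.1 h3).resolve_left hl.ne'
      have h4 : 0 ≤ ψ u v := sub_nonneg.2 (hmin u v hu hv h0)
      exact (mul_nonneg hl.le h4).trans h2) (by
      rintro ⟨y, t⟩
      obtain ⟨l, hl, u, v, hu, hv, h⟩ := hL _ (L.starProjection_apply_mem y)
      refine ⟨⟨(L.starProjection y - y, l * ψ u v - t), ?_, trivial⟩, l, hl, u, v, hu, hv, ?_, ?_⟩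
      · have := L.sub_starProjection_mem_orthogonal y
        rw [← neg_sub]
        exact Lᗮ.neg_mem this
      · simpa using h
      · simp)
  let g₁ : X →L[ℝ] ℝ := (g.comp (LinearMap.inl ℝ X ℝ)).toContinuousLinearMap
  refine ⟨(InnerProductSpace.toDual ℝ X).symm g₁, fun u v hu hv => ?_⟩
  rw [InnerProductSpace.toDual_symm_apply]
  have h1 := hgs (constr A B c u v, ψ u v) ⟨1, one_pos, u, v, hu, hv, by simp, by simp⟩
  have h2 : g (0, ψ u v) = ψ u v := hgf ⟨(0, ψ u v), Lᗮ.zero_mem, trivial⟩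
  have h3 : g (constr A B c u v, ψ u v) = g₁ (constr A B c u v) + g (0, ψ u v) := by
    change _ = g (constr A B c u v, 0) + _
    rw [← map_add]; simp
  rw [h3, h2] at h1
  simp only [ψ] at h1
  linarith

/-- Under the constraint qualification an optimal solution has a multiplier. -/
theorem kktSet_nonempty {Q G : WithLp 2 (U × V) →L[ℝ] WithLp 2 (U × V)}
    (hp : ClosedProperConvex p) (hq : ClosedProperConvex q) (hφ : HessianBounds φ Q G)
    (hsol : (solutionSet p q φ A B c).Nonempty) (hCQ : ConstraintQualification p q A B c) :
    (kktSet p q φ A B c).Nonempty := by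
  obtain ⟨⟨u₁, v₁⟩, hfeas, hopt⟩ := hsol
  simp only at hfeas hopt
  have hobj : ∀ u v, p u < ⊤ → q v < ⊤ → objective p q φ u v
      = (((p u).toReal + (q v).toReal + φ (pair u v) : ℝ) : EReal) := by
    intro u v hu hv
    rw [objective, EReal.coe_add, EReal.coe_add, hp.coe_toReal hu, hq.coe_toReal hv]
  have hdom : p u₁ < ⊤ ∧ q v₁ < ⊤ := by
    obtain ⟨⟨u₀, v₀⟩, hz, hz0⟩ := hCQ
    obtain ⟨hu₀, hv₀⟩ := intrinsicInterior_subset hz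
    have h := hopt u₀ v₀ hz0
    rw [hobj u₀ v₀ hu₀ hv₀] at h
    constructor
    · by_contra hne
      rw [objective, not_lt_top_iff.1 hne, EReal.top_add_of_ne_bot (hq.ne_bot _),
        EReal.top_add_coe] at h
      exact EReal.coe_ne_top _ (top_le_iff.1 h)
    · by_contra hne
      rw [objective, not_lt_top_iff.1 hne, EReal.add_top_of_ne_bot (hp.ne_bot _),
        EReal.top_add_coe] at h
      exact EReal.coe_ne_top _ (top_le_iff.1 h)
  obtain ⟨hu₁, hv₁⟩ := hdom
  set γ := gradient φ (pair u₁ v₁) with hγ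
  -- The optimal point also minimizes the problem with `φ` linearized there: along a feasible
  -- segment the linearization error is quadratic in `t`.
  obtain ⟨x, hx⟩ := exists_multiplier hp hq hCQ (innerSL ℝ γ)
    ((p u₁).toReal + (q v₁).toReal + innerSL ℝ γ (pair u₁ v₁)) (by
      intro u v hu hv h0
      set d := pair u v - pair u₁ v₁ with hd
      have := nonneg_of_forall_quadratic (a := (p u).toReal + (q v).toReal + ⟪γ, d⟫_ℝ
          - (p u₁).toReal - (q v₁).toReal) (m := 1 / 2 * ⟪d, G d⟫_ℝ) (by
        intro t ht ht1
        obtain ⟨hu', hu''⟩ := hp.toReal_le_combo hu₁ hu ht.le ht1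
        obtain ⟨hv', hv''⟩ := hq.toReal_le_combo hv₁ hv ht.le ht1
        have h1 := hopt (u₁ + t • (u - u₁)) (v₁ + t • (v - v₁)) (by
          rw [constr_combo, hfeas, h0]; simp)
        rw [hobj _ _ hu₁ hv₁, hobj _ _ hu' hv', EReal.coe_le_coe_iff] at h1
        have h2 := hφ.le_upper (pair u₁ v₁) (t • d)
        rw [map_smul, inner_smul_left, inner_smul_right, inner_smul_right, conj_trivial] at h2
        have h3 : pair (u₁ + t • (u - u₁)) (v₁ + t • (v - v₁)) = pair u₁ v₁ + t • d := by
          rw [pair_add, pair_smul, pair_sub]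
        rw [h3] at h1
        linarith)
      rw [hd, inner_sub_right] at this
      simp only [innerSL_apply_apply]
      linarith) ⟨u₁, v₁, hu₁, hv₁, hfeas, le_rfl⟩
  simp only [innerSL_apply_apply] at hx
  refine ⟨(u₁, v₁, x), ⟨-(γ.fst + A x), ?_, -(γ.snd + B x), ?_, ?_⟩, hfeas⟩
  · rw [hp.mem_subdifferential_iff hu₁]
    intro u hu
    have h1 := hx u v₁ hu hv₁
    have h2 : constr A B c u v₁ = A.adjoint (u - u₁) := by
      have := constr_add_left (A := A) (B := B) (c := c) u₁ (u - u₁) v₁ 1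
      rw [hfeas] at this
      simpa using this
    have h3 : ⟪γ, pair u v₁⟫_ℝ - ⟪γ, pair u₁ v₁⟫_ℝ = ⟪γ.fst, u - u₁⟫_ℝ := by
      rw [inner_fst_eq, ← inner_sub_right, ← pair_sub]; simp
    rw [h2, ContinuousLinearMap.adjoint_inner_right] at h1
    rw [inner_neg_left, inner_add_left]
    linarith
  · rw [hq.mem_subdifferential_iff hv₁]
    intro v hv
    have h1 := hx u₁ v hu₁ hv
    have h2 : constr A B c u₁ v = B.adjoint (v - v₁) := by
      have := constr_add_right (A := A) (B := B) (c := c) u₁ v₁ (v - v₁) 1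
      rw [hfeas] at this
      simpa using this
    have h3 : ⟪γ, pair u₁ v⟫_ℝ - ⟪γ, pair u₁ v₁⟫_ℝ = ⟪γ.snd, v - v₁⟫_ℝ := by
      rw [inner_snd_eq, ← inner_sub_right, ← pair_sub]; simp
    rw [h2, ContinuousLinearMap.adjoint_inner_right] at h1
    rw [inner_neg_left, inner_add_left]
    linarith
  · change 0 = γ + pair (-(γ.fst + A x) + A x) (-(γ.snd + B x) + B x)
    have : γ = pair γ.fst γ.snd := rfl
    rw [neg_add, neg_add, neg_add_cancel_right, neg_add_cancel_right]
    nth_rw 1 [this]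
    rw [← pair_add]
    simp
    rfl

end Multiplier

/-! ### Error dynamics, the KKT residual bound and running minima. -/

section Convergence

variable {U V X : Type*}
  [NormedAddCommGroup U] [InnerProductSpace ℝ U] [FiniteDimensional ℝ U]
  [NormedAddCommGroup V] [InnerProductSpace ℝ V] [FiniteDimensional ℝ V]
  [NormedAddCommGroup X] [InnerProductSpace ℝ X] [FiniteDimensional ℝ X]
  {p : U → EReal} {q : V → EReal} {φ : WithLp 2 (U × V) → ℝ}
  {A : X →L[ℝ] U} {B : X →L[ℝ] V} {c : X}
  {Q G : WithLp 2 (U × V) →L[ℝ] WithLp 2 (U × V)}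
  {D₁ S : U →L[ℝ] U} {D₂ T : V →L[ℝ] V} {σ τ η : ℝ}
  {u : ℕ → U} {v : ℕ → V} {x : ℕ → X}

/-- The three-point inequality for the linearization error of the smooth part. -/
theorem HessianBounds.three_point {E : Type*} [NormedAddCommGroup E] [InnerProductSpace ℝ E]
    [FiniteDimensional ℝ E] {φ : E → ℝ} {Q G : E →L[ℝ] E} (h : HessianBounds φ Q G)
    (w w' w₀ : E) :
    -⟪gradient φ w - gradient φ w₀, w' - w₀⟫_ℝ ≤ 1 / 2 * sqNorm G (w' - w)
      - 1 / 2 * sqNorm Q (w - w₀) - 1 / 2 * sqNorm Q (w' - w₀) := by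
  -- The upper bound from `w` to `w'` and the lower bounds from `w` to `w₀` and from `w₀` to `w'`
  -- are combined so that all values of `φ` cancel.
  have h1 := h.le_upper w (w' - w)
  have h2 := h.lower_le w (w₀ - w)
  have h3 := h.lower_le w₀ (w' - w₀)
  rw [sqNorm_sub_comm Q w w₀]
  simp only [add_sub_cancel, inner_sub_right (gradient φ _)] at h1 h2 h3
  simp only [sqNorm]
  rw [inner_sub_left, inner_sub_right (gradient φ _), inner_sub_right (gradient φ _)]
  linarith

theorem constr_eq_of_feasible {u₀ : U} {v₀ : V} (h : constr A B c u₀ v₀ = 0) (u : U) (v : V) :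
    constr A B c u v = A.adjoint (u - u₀) + B.adjoint (v - v₀) := by
  have : constr A B c u v = constr A B c u v - constr A B c u₀ v₀ := by rw [h, sub_zero]
  rw [this]
  simp only [constr, map_sub]
  abel

theorem IsMajorizedADMM.errorDynamics (hp : ClosedProperConvex p) (hq : ClosedProperConvex q)
    (hQ : Q.IsPositive) (hD₁ : D₁.IsPositive) (hD₂ : D₂.IsPositive)
    (hS : S.IsPositive) (hT : T.IsPositive) (hσ : 0 < σ) (hτ : 0 < τ)
    (hφ : HessianBounds φ Q (Q + blockDiag D₁ D₂))
    (hcoup : ∀ (w : WithLp 2 (U × V)) (a : U) (b y : V),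
      -⟪pair 0 y, gradient φ (w + pair a b) - gradient φ w - Q (pair a b)⟫_ℝ + ⟪y, D₂ b⟫_ℝ
      ≤ η / 2 * (sqNorm D₁ a + sqNorm D₂ y) + 1 / 2 * (sqNorm D₂ b + sqNorm D₂ y))
    (h : IsMajorizedADMM p q φ A B c (Q + blockDiag D₁ D₂) S T σ τ u v x)
    {u₀ : U} {v₀ : V} {x₀ : X} (hkkt : (u₀, v₀, x₀) ∈ kktSet p q φ A B c) :
    ErrorDynamics A B Q D₁ S D₂ T σ τ η (fun k => u k - u₀) (fun k => v k - v₀)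
      (fun k => x k - x₀) (fun k => constr A B c (u k) (v k)) := by
  obtain ⟨⟨ξ, hξ, ζ, hζ, h0⟩, hfeas⟩ := hkkt
  simp only at hξ hζ h0 hfeas
  have hG : (Q + blockDiag D₁ D₂).IsPositive := hQ.add (blockDiag_isPositive hD₁ hD₂)
  have hξ' : ξ = -((gradient φ (pair u₀ v₀)).fst + A x₀) := by
    have : (0 : U) = (gradient φ (pair u₀ v₀)).fst + (ξ + A x₀) := congrArg WithLp.fst h0
    rw [eq_neg_iff_add_eq_zero, this]; abel
  have hζ' : ζ = -((gradient φ (pair u₀ v₀)).snd + B x₀) := by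
    have : (0 : V) = (gradient φ (pair u₀ v₀)).snd + (ζ + B x₀) := congrArg WithLp.snd h0
    rw [eq_neg_iff_add_eq_zero, this]; abel
  refine ⟨fun k => constr_eq_of_feasible hfeas _ _, fun k => ?_, fun k => ?_, fun k => ?_⟩
  · rw [h.step_x k]; abel
  · have m₁ := hp.subdifferential_monotone (h.subgrad_u hp hq hG hS k) hξ
    have m₂ := hq.subdifferential_monotone (h.subgrad_v hp hq hG hT k) hζ
    have m₃ := hφ.three_point (pair (u k) (v k)) (pair (u (k + 1)) (v (k + 1))) (pair u₀ v₀)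
    rw [constr_eq_of_feasible hfeas]
    rw [constr_eq_of_feasible hfeas, hξ'] at m₁
    rw [constr_eq_of_feasible hfeas, hζ'] at m₂
    simp only [← pair_sub] at m₃
    refine energy_descent hQ hD₁ hD₂ hS hT hσ hτ
      (γ := gradient φ (pair (u k) (v k)) - gradient φ (pair u₀ v₀)) ?_ ?_ ?_ ?_
    · rw [h.step_x k, constr_eq_of_feasible hfeas]; abel
    · simp only [sub_sub_sub_cancel_right]
      rw [ContinuousLinearMap.adjoint_inner_right, ← inner_fst_eq, WithLp.add_fst, WithLp.sub_fst,
        ← inner_neg_left, ← inner_sub_left, ← inner_sub_left]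
      rw [WithLp.add_fst] at m₁
      convert m₁ using 2
      simp only [map_add, map_sub]
      abel
    · simp only [sub_sub_sub_cancel_right]
      rw [ContinuousLinearMap.adjoint_inner_right, ← inner_snd_eq, WithLp.add_snd, WithLp.sub_snd,
        ← inner_neg_left, ← inner_sub_left, ← inner_sub_left]
      rw [WithLp.add_snd] at m₂
      convert m₂ using 2
      simp only [map_add, map_sub]
      abel
    · simp only [sub_sub_sub_cancel_right]
      exact m₃
  -- Comparing two consecutive `v`-steps, instead of an iterate and the KKT point, exposes the
  -- change of gradient, which `hcoup` bounds.
  · have m := hq.subdifferential_monotone (h.subgrad_v hp hq hG hT (k + 1))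
      (h.subgrad_v hp hq hG hT k)
    have hc := hcoup (pair (u k) (v k)) (u (k + 1) - u k) (v (k + 1) - v k)
      (v (k + 2) - v (k + 1))
    rw [← pair_add, add_sub_cancel, add_sub_cancel] at hc
    simp only [sub_sub_sub_cancel_right, ← pair_sub]
    simp only [add_assoc, one_add_one_eq_two] at m
    rw [h.step_x k] at m
    set r₁ := constr A B c (u (k + 1)) (v (k + 1))
    set r₂ := constr A B c (u (k + 2)) (v (k + 2))
    set y := v (k + 2) - v (k + 1)
    set Δ₂ := pair (u (k + 2) - u (k + 1)) y
    set b := v (k + 1) - v k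
    set Δ₁ := pair (u (k + 1) - u k) b
    set g₁ := gradient φ (pair (u (k + 1)) (v (k + 1)))
    set g₀ := gradient φ (pair (u k) (v k))
    have e1 : ⟪pair 0 y, Q Δ₂⟫_ℝ = ⟪(Q Δ₂).snd, y⟫_ℝ := by
      rw [inner_snd_eq, real_inner_comm]
    have e2 : ⟪pair 0 y, g₁ - g₀ - Q Δ₁⟫_ℝ = ⟪g₁.snd - g₀.snd - (Q Δ₁).snd, y⟫_ℝ := by
      rw [real_inner_comm, ← inner_snd_eq, WithLp.sub_snd, WithLp.sub_snd]
    have e3 : ∀ r, ⟪B.adjoint y, r⟫_ℝ = ⟪B r, y⟫_ℝ := fun r => by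
      rw [real_inner_comm, ContinuousLinearMap.adjoint_inner_right]
    have e4 : ((blockDiag D₁ D₂) Δ₂).snd = D₂ y := rfl
    have e5 : ((blockDiag D₁ D₂) Δ₁).snd = D₂ b := rfl
    have e6 := two_inner_le hT y b
    rw [e2] at hc
    rw [e1, e3, e3]
    simp only [WithLp.add_snd, add_apply, e4, e5, map_add, map_smul, inner_sub_left, inner_neg_left,
      inner_add_left, inner_smul_left, conj_trivial] at m hc
    rw [real_inner_comm y (D₂ y), real_inner_comm y (D₂ b), real_inner_comm y (T y),
      real_inner_comm y (T b)] at m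
    simp only [sqNorm] at hc ⊢
    linarith

/-- The KKT residual is bounded by the squared step length and the squared constraint residual. -/
theorem exists_kktResidual_le (A : X →L[ℝ] U) (B : X →L[ℝ] V)
    (G : WithLp 2 (U × V) →L[ℝ] WithLp 2 (U × V)) (S : U →L[ℝ] U) (T : V →L[ℝ] V) (σ τ : ℝ)
    (hG : G.IsPositive) (hS : S.IsPositive) (hT : T.IsPositive) :
    ∃ M : ℝ, 0 ≤ M ∧ ∀ (p : U → EReal) (q : V → EReal) (φ : WithLp 2 (U × V) → ℝ) (c : X),
      ClosedProperConvex p → ClosedProperConvex q →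
      (∀ w d, ‖gradient φ (w + d) - gradient φ w‖ ^ 2 ≤ ‖G‖ * (‖G‖ + 1) * ‖d‖ ^ 2) →
      ∀ (u : ℕ → U) (v : ℕ → V) (x : ℕ → X), IsMajorizedADMM p q φ A B c G S T σ τ u v x →
      ∀ k, kktResidual p q φ A B c (u (k + 1)) (v (k + 1)) (x (k + 1))
        ≤ ENNReal.ofReal (M * (‖u (k + 1) - u k‖ ^ 2 + ‖v (k + 1) - v k‖ ^ 2
          + ‖constr A B c (u (k + 1)) (v (k + 1))‖ ^ 2)) := by
  set N := ‖G‖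
  set K₁ := N + ‖A‖ * (|τ * σ - σ| + |σ| * ‖B.adjoint‖) + ‖S‖ with hK₁
  set K₂ := N + ‖B‖ * |τ * σ - σ| + ‖T‖ with hK₂
  have hN : 0 ≤ N := norm_nonneg G
  refine ⟨2 * (N * (N + 1)) + 6 * (K₁ ^ 2 + K₂ ^ 2) + 1, by positivity, ?_⟩
  intro p q φ c hp hq hL u v x h k
  have hu := h.subgrad_u hp hq hG hS k
  have hv := h.subgrad_v hp hq hG hT k
  set Δu := u (k + 1) - u k with hΔu
  set Δv := v (k + 1) - v k with hΔv
  set r := constr A B c (u (k + 1)) (v (k + 1)) with hr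
  have hr' : constr A B c (u (k + 1)) (v k) = r - B.adjoint Δv := by
    simp only [hr, hΔv, constr, map_sub]; abel
  rw [hr'] at hu
  set g₀ := gradient φ (pair (u k) (v k))
  set g₁ := gradient φ (pair (u (k + 1)) (v (k + 1))) with hg₁
  set ξ := -((g₀ + G (pair Δu 0)).fst + A (x k + σ • (r - B.adjoint Δv)) + S Δu) with hξ
  set ζ := -((g₀ + G (pair Δu Δv)).snd + B (x k + σ • r) + T Δv) with hζ
  -- `Y` and `Z` are what the subproblem conditions leave after the gradient at the old point is
  -- cancelled and the multiplier is changed to `x (k + 1)`. With `g₁ - g₀` they form an explicit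
  -- element of the KKT map, small when step and residual are.
  set Y := -(G (pair Δu 0)).fst + A ((τ * σ - σ) • r + σ • B.adjoint Δv) - S Δu with hY
  set Z := -(G (pair Δu Δv)).snd + B ((τ * σ - σ) • r) - T Δv with hZ
  have hmem : g₁ - g₀ + pair Y Z ∈ kktMap p q φ A B (u (k + 1)) (v (k + 1)) (x (k + 1)) := by
    refine ⟨ξ, hu, ζ, hv, ?_⟩
    rw [h.step_x k]
    have e1 : ξ + A (x k + (τ * σ) • r) = Y - g₀.fst := by
      simp only [hξ, hY, WithLp.add_fst, map_add, map_smul, map_sub]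
      module
    have e2 : ζ + B (x k + (τ * σ) • r) = Z - g₀.snd := by
      simp only [hζ, hZ, WithLp.add_snd, map_add, map_smul]
      module
    rw [e1, e2, pair_sub Y g₀.fst Z g₀.snd, ← hg₁]
    have e3 : pair g₀.fst g₀.snd = g₀ := rfl
    rw [e3]
    abel
  have h1 : Metric.infEDist 0 (kktMap p q φ A B (u (k + 1)) (v (k + 1)) (x (k + 1))) ^ 2
      ≤ ENNReal.ofReal (‖g₁ - g₀ + pair Y Z‖ ^ 2) := by
    rw [ENNReal.ofReal_pow (norm_nonneg _)]
    gcongr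
    refine (Metric.infEDist_le_edist_of_mem hmem).trans ?_
    rw [edist_dist, dist_zero_left]
  set t := ‖Δu‖ + ‖Δv‖ + ‖r‖ with ht
  have tu : ‖Δu‖ ≤ t := by have := norm_nonneg Δv; have := norm_nonneg r; linarith
  have tv : ‖Δv‖ ≤ t := by have := norm_nonneg Δu; have := norm_nonneg r; linarith
  have tr : ‖r‖ ≤ t := by have := norm_nonneg Δv; have := norm_nonneg Δu; linarith
  have tuv : ‖pair Δu Δv‖ ≤ t := by
    refine le_trans ?_ (show ‖Δu‖ + ‖Δv‖ ≤ t by have := norm_nonneg r; linarith)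
    apply le_of_sq_le_sq _ (by positivity)
    rw [norm_pair_sq]
    nlinarith [norm_nonneg Δu, norm_nonneg Δv]
  have tu0 : ‖pair Δu (0 : V)‖ ≤ t := by
    refine le_trans (le_of_sq_le_sq ?_ (norm_nonneg _)) tu
    rw [norm_pair_sq]; simp
  have ht0 : 0 ≤ t := by positivity
  have hYt : ‖Y‖ ≤ K₁ * t := by
    have b1 : ‖(G (pair Δu 0)).fst‖ ≤ N * t :=
      (norm_fst_le _).trans ((G.le_opNorm _).trans (by gcongr))
    have b2 : ‖(τ * σ - σ) • r + σ • B.adjoint Δv‖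
        ≤ (|τ * σ - σ| + |σ| * ‖B.adjoint‖) * t := by
      refine (norm_add_le _ _).trans ?_
      rw [norm_smul, norm_smul, Real.norm_eq_abs, Real.norm_eq_abs, add_mul, mul_assoc]
      gcongr
      exact (B.adjoint.le_opNorm _).trans (by gcongr)
    have b3 : ‖A ((τ * σ - σ) • r + σ • B.adjoint Δv)‖
        ≤ ‖A‖ * ((|τ * σ - σ| + |σ| * ‖B.adjoint‖) * t) := (A.le_opNorm _).trans (by gcongr)
    have b4 : ‖S Δu‖ ≤ ‖S‖ * t := (S.le_opNorm _).trans (by gcongr)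
    have b5 := norm_sub_le (-(G (pair Δu 0)).fst + A ((τ * σ - σ) • r + σ • B.adjoint Δv)) (S Δu)
    have b6 := norm_add_le (-(G (pair Δu 0)).fst) (A ((τ * σ - σ) • r + σ • B.adjoint Δv))
    rw [norm_neg] at b6
    have b7 : K₁ * t = N * t + ‖A‖ * ((|τ * σ - σ| + |σ| * ‖B.adjoint‖) * t) + ‖S‖ * t := by
      rw [hK₁]; ring
    linarith
  have hZt : ‖Z‖ ≤ K₂ * t := by
    have b1 : ‖(G (pair Δu Δv)).snd‖ ≤ N * t :=
      (norm_snd_le _).trans ((G.le_opNorm _).trans (by gcongr))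
    have b2 : ‖(τ * σ - σ) • r‖ ≤ |τ * σ - σ| * t := by
      rw [norm_smul, Real.norm_eq_abs]
      gcongr
    have b3 : ‖B ((τ * σ - σ) • r)‖ ≤ ‖B‖ * (|τ * σ - σ| * t) := (B.le_opNorm _).trans (by gcongr)
    have b4 : ‖T Δv‖ ≤ ‖T‖ * t := (T.le_opNorm _).trans (by gcongr)
    have b5 := norm_sub_le (-(G (pair Δu Δv)).snd + B ((τ * σ - σ) • r)) (T Δv)
    have b6 := norm_add_le (-(G (pair Δu Δv)).snd) (B ((τ * σ - σ) • r))
    rw [norm_neg] at b6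
    have b7 : K₂ * t = N * t + ‖B‖ * (|τ * σ - σ| * t) + ‖T‖ * t := by
      rw [hK₂]; ring
    linarith
  have ht2 : t ^ 2 ≤ 3 * (‖Δu‖ ^ 2 + ‖Δv‖ ^ 2 + ‖r‖ ^ 2) := by
    rw [ht]
    nlinarith [sq_nonneg (‖Δu‖ - ‖Δv‖), sq_nonneg (‖Δu‖ - ‖r‖), sq_nonneg (‖Δv‖ - ‖r‖)]
  have hYZ : ‖pair Y Z‖ ^ 2 ≤ (K₁ ^ 2 + K₂ ^ 2) * t ^ 2 := by
    rw [norm_pair_sq]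
    have b1 : ‖Y‖ ^ 2 ≤ (K₁ * t) ^ 2 := by gcongr
    have b2 : ‖Z‖ ^ 2 ≤ (K₂ * t) ^ 2 := by gcongr
    linarith [mul_pow K₁ t 2, mul_pow K₂ t 2]
  have hg : ‖g₁ - g₀‖ ^ 2 ≤ N * (N + 1) * (‖Δu‖ ^ 2 + ‖Δv‖ ^ 2) := by
    have := hL (pair (u k) (v k)) (pair Δu Δv)
    rwa [← pair_add, hΔu, hΔv, add_sub_cancel, add_sub_cancel, norm_pair_sq] at this
  have hfin := norm_add_sq_le_two (g₁ - g₀) (pair Y Z)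
  have hK : (K₁ ^ 2 + K₂ ^ 2) * t ^ 2
      ≤ (K₁ ^ 2 + K₂ ^ 2) * (3 * (‖Δu‖ ^ 2 + ‖Δv‖ ^ 2 + ‖r‖ ^ 2)) := by gcongr
  have hNr : 0 ≤ N * (N + 1) * ‖r‖ ^ 2 := by positivity
  rw [kktResidual]
  refine (add_le_add_left h1 _).trans ?_
  rw [← ENNReal.ofReal_add (by positivity) (by positivity)]
  apply ENNReal.ofReal_le_ofReal
  have := sq_nonneg ‖Δu‖
  have := sq_nonneg ‖Δv‖
  linarith

/-- The running minimum of a sequence with bounded partial sums is `O(1/k)` and `o(1/k)`. -/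
theorem iInf_Icc_le_and_tendsto {R : ℕ → ℝ≥0∞} {a : ℕ → ℝ} {C : ℝ} (ha : ∀ i, 0 ≤ a i)
    (hR : ∀ i, R (i + 1) ≤ ENNReal.ofReal (a i)) (hC : ∀ n, ∑ i ∈ Finset.range n, a i ≤ C) :
    (∀ k : ℕ, 1 ≤ k → ⨅ i ∈ Finset.Icc 1 k, R i ≤ (C.toNNReal : ℝ≥0∞) / (k : ℝ≥0∞)) ∧
      Tendsto (fun k : ℕ => (k : ℝ≥0∞) * ⨅ i ∈ Finset.Icc 1 k, R i) atTop (𝓝 0) := by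
  -- A minimum is at most each term of a window. The window `[0, k)` gives the `O(1/k)` bound;
  -- `[k/2, k)` has at least `k/2` terms and a sum tending to zero, which gives `o(1/k)`.
  have key : ∀ l k : ℕ, l ≤ k → ((k - l : ℕ) : ℝ≥0∞) * ⨅ i ∈ Finset.Icc 1 k, R i
      ≤ ENNReal.ofReal (∑ i ∈ Finset.Ico l k, a i) := by
    intro l k hlk
    have h1 : ∀ i ∈ Finset.Ico l k, ⨅ i ∈ Finset.Icc 1 k, R i ≤ ENNReal.ofReal (a i) := by
      intro i hi
      rw [Finset.mem_Ico] at hi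
      exact (iInf₂_le (i + 1) (Finset.mem_Icc.2 ⟨by omega, by omega⟩)).trans (hR i)
    have h2 := Finset.card_nsmul_le_sum _ _ _ h1
    rwa [Nat.card_Ico, nsmul_eq_mul, ← ENNReal.ofReal_sum_of_nonneg (fun i _ => ha i)] at h2
  constructor
  · intro k hk
    have h1 := key 0 k (Nat.zero_le k)
    rw [Nat.sub_zero, ← Finset.range_eq_Ico] at h1
    rw [ENNReal.le_div_iff_mul_le (Or.inl (by simp; omega)) (Or.inl (by simp)), mul_comm]
    exact h1.trans (ENNReal.ofReal_le_ofReal (hC k))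
  · have hsum : Summable a := summable_of_sum_range_le ha hC
    have ht := hsum.hasSum.tendsto_sum_nat
    have hhalf : Tendsto (fun k : ℕ => k / 2) atTop atTop :=
      tendsto_atTop_mono (fun k => le_rfl) (Nat.tendsto_div_const_atTop two_ne_zero)
    have h1 : Tendsto (fun k : ℕ => 2 * ENNReal.ofReal (∑ i ∈ Finset.Ico (k / 2) k, a i)) atTop
        (𝓝 0) := by
      have h2 : Tendsto (fun k : ℕ => ∑ i ∈ Finset.Ico (k / 2) k, a i) atTop (𝓝 0) := by
        have := ht.sub (ht.comp hhalf)
        rw [sub_self] at this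
        refine this.congr fun k => ?_
        rw [Finset.sum_Ico_eq_sub _ (Nat.div_le_self k 2)]
        rfl
      have h3 := ENNReal.Tendsto.const_mul (a := 2)
        (ENNReal.tendsto_ofReal h2) (Or.inr (by simp))
      simpa using h3
    refine tendsto_of_tendsto_of_tendsto_of_le_of_le tendsto_const_nhds h1
      (fun _ => zero_le) fun k => ?_
    refine le_trans ?_ (mul_le_mul_right (key (k / 2) k (Nat.div_le_self k 2)) 2)
    rw [← mul_assoc]
    gcongr
    have : k ≤ 2 * (k - k / 2) := by omega
    exact_mod_cast this

end Convergence

end MajorizedADMM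

/-! ### The convergence rates. -/

theorem theorem4p2 {U V X : Type*}
    [NormedAddCommGroup U] [InnerProductSpace ℝ U] [FiniteDimensional ℝ U]
    [NormedAddCommGroup V] [InnerProductSpace ℝ V] [FiniteDimensional ℝ V]
    [NormedAddCommGroup X] [InnerProductSpace ℝ X] [FiniteDimensional ℝ X]
    (A : X →L[ℝ] U) (B : X →L[ℝ] V)
    (Q : WithLp 2 (U × V) →L[ℝ] WithLp 2 (U × V))
    (D₁ S : U →L[ℝ] U) (D₂ T : V →L[ℝ] V) (σ τ η : ℝ)
    (hQ : Q.IsPositive) (hD₁ : D₁.IsPositive) (hD₂ : D₂.IsPositive)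
    (hS : S.IsPositive) (hT : T.IsPositive)
    (hσ : 0 < σ) (hη₀ : 0 ≤ η) (hη₁ : η ≤ 1)
    (hcond :
      (0 < τ ∧ τ ≤ 1 ∧
        PosDef ((1 / 4 : ℝ) • Q
          + blockDiag (S + ((1 - τ) * σ) • (A ∘L A.adjoint))
              (T + ((1 - τ) * σ) • (B ∘L B.adjoint)))) ∨
      (0 < τ ∧ τ < (1 + Real.sqrt 5) / 2 ∧
        ((1 / 4 : ℝ) • Q + blockDiag (S - η • D₁) (T - η • D₂)).IsPositive ∧
        PosDef ((1 / 4 : ℝ) • Q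
          + blockDiag (S + σ • (A ∘L A.adjoint) - η • D₁)
              (T + σ • (B ∘L B.adjoint) - η • D₂)))) :
    -- The constant is a function of the initial point and of the primal-dual optimal set, chosen
    -- before the objective functions, the right-hand side and the sequence.
    ∃ C : U × V × X → Set (U × V × X) → ℝ≥0,
      ∀ (p : U → EReal) (q : V → EReal) (φ : WithLp 2 (U × V) → ℝ) (c : X),
        ClosedProperConvex p → ClosedProperConvex q →
        ConvexOn ℝ Set.univ φ → Differentiable ℝ φ → (∃ L : ℝ≥0, LipschitzWith L (gradient φ)) →
        (∀ w, ∀ W ∈ genHessian φ w,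
          (W - Q).IsPositive ∧ (Q + blockDiag D₁ D₂ - W).IsPositive) →
        (∀ w, ∀ W ∈ genHessian φ w, ∀ (u : U) (v : V),
          |⟪u, block₁₂ W v - block₁₂ Q v⟫_ℝ| ≤ η / 2 * (sqNorm D₁ u + sqNorm D₂ v)) →
        (solutionSet p q φ A B c).Nonempty →
        ConstraintQualification p q A B c →
        ∀ (u : ℕ → U) (v : ℕ → V) (x : ℕ → X),
          IsMajorizedADMM p q φ A B c (Q + blockDiag D₁ D₂) S T σ τ u v x →
          (∀ k : ℕ, 1 ≤ k →
            ⨅ i ∈ Finset.Icc 1 k, kktResidual p q φ A B c (u (i + 1)) (v (i + 1)) (x (i + 1))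
              ≤ (C (u 0, v 0, x 0) (kktSet p q φ A B c) : ℝ≥0∞) / (k : ℝ≥0∞)) ∧
          Tendsto (fun k : ℕ => (k : ℝ≥0∞) *
            ⨅ i ∈ Finset.Icc 1 k, kktResidual p q φ A B c (u (i + 1)) (v (i + 1)) (x (i + 1)))
            atTop (𝓝 0) := by
  have hτ : 0 < τ := hcond.elim (fun h => h.1) (fun h => h.1)
  have hG : (Q + blockDiag D₁ D₂).IsPositive := hQ.add (blockDiag_isPositive hD₁ hD₂)
  obtain ⟨M, hM, hsum⟩ : ∃ M, 0 ≤ M ∧ ∀ (a : ℕ → U) (b : ℕ → V) (y r : ℕ → X),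
      ErrorDynamics A B Q D₁ S D₂ T σ τ η a b y r → ∀ n,
      ∑ i ∈ Finset.range n, (‖a (i + 2) - a (i + 1)‖ ^ 2 + ‖b (i + 2) - b (i + 1)‖ ^ 2
        + ‖r (i + 2)‖ ^ 2) ≤ M * errSq (a 0) (b 0) (y 0) := by
    rcases hcond with ⟨_, hτ₁, hO⟩ | ⟨_, hτ₁, hP, hO⟩
    · exact exists_sum_bound_of_le_one hQ hD₁ hD₂ hS hT hσ hτ hτ₁ hO
    · exact exists_sum_bound_of_lt_golden hQ hD₁ hD₂ hS hT hσ hτ hη₀ hτ₁ hP hO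
  obtain ⟨M', hM', hres⟩ := exists_kktResidual_le A B (Q + blockDiag D₁ D₂) S T σ τ hG hS hT
  classical
  -- The reference KKT point is chosen from the set `K` alone, so the constant depends on the
  -- problem only through that set. The value `0` for empty `K` never matters, because the KKT set
  -- is nonempty here.
  refine ⟨fun z K => if h : K.Nonempty then
    (M' * (M * errSq (z.1 - h.some.1) (z.2.1 - h.some.2.1) (z.2.2 - h.some.2.2))).toNNReal else 0,
    ?_⟩
  intro p q φ c hp hq _ hφd hLip hH hη hsol hCQ u v x hadmm
  obtain ⟨L, hL⟩ := hLip
  have hφ := HessianBounds.of_genHessian hφd hL hH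
  have hne := kktSet_nonempty hp hq hφ hsol hCQ
  have hdyn := hadmm.errorDynamics hp hq hQ hD₁ hD₂ hS hT hσ hτ hφ (coupling_bound hL hH hη)
    hne.some_mem
  simp only [dif_pos hne]
  refine iInf_Icc_le_and_tendsto
    (R := fun i => kktResidual p q φ A B c (u (i + 1)) (v (i + 1)) (x (i + 1)))
    (a := fun i => M' * (‖u (i + 2) - u (i + 1)‖ ^ 2 + ‖v (i + 2) - v (i + 1)‖ ^ 2
      + ‖constr A B c (u (i + 2)) (v (i + 2))‖ ^ 2))
    (fun i => by positivity)
    (fun i => hres p q φ c hp hq (norm_gradient_sub_sq_le hQ hL hH) u v x hadmm (i + 1))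
    (fun n => ?_)
  have h := hsum _ _ _ _ hdyn n
  simp only [sub_sub_sub_cancel_right] at h
  rw [← Finset.mul_sum]
  gcongr
  exact h
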